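/- Let $d,m\ge 1$ be integers, $p\in\,]1,\infty[$, $\alpha>0$, and let $\Omega\subset\mathbb R^d$ be a bounded open set with Lebesgue measure $\lambda$. Write $\mathcal O(\Omega)$ for the open subsets of $\Omega$, and for $V\in\mathcal O(\Omega)$ let $W^{1,p}_0(V;\mathbb R^m)$ be the closure in $W^{1,p}(\Omega;\mathbb R^m)$ of $C^\infty_c(V;\mathbb R^m)$. Let $F:W^{1,p}(\Omega;\mathbb R^m)\times\mathcal O(\Omega)\to[0,\infty]$ satisfy, for all $V\in\mathcal O(\Omega)$ and all $u,v\in W^{1,p}(\Omega;\mathbb R^m)$: (C0) $F(u;V)\ge\alpha\int_V|\nabla u|^p\,dx$; (C1) $F(u;\cdot)$ is the restriction to $\mathcal O(\Omega)$ of a (possibly infinite) Borel measure on $\Omega$ absolutely continuous with respect to $\lambda$; (C2) if $u=v$ a.e. in $V$, then $F(u;V)=F(v;V)$. For $w\in W^{1,p}(\Omega;\mathbb R^m)$ and $V\in\mathcal O(\Omega)$ put $$m(w;V):=\inf\{F(v;V):v\in w+W^{1,p}_0(V;\mathbb R^m)\}.$$ Let $Q_\rho(x)=x+\rho\,]-\tfrac12,\tfrac12[^d$,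 and for $u\in W^{1,p}(\Omega;\mathbb R^m)$ let $u_x(y)=u(x)+\nabla u(x)(y-x)$. For $O\in\mathcal O(\Omega)$ define $$\mathcal F_0(u;O):=\inf\Big\{\liminf_{\varepsilon\to0}F(v_\varepsilon;O): v_\varepsilon\in W^{1,p}(\Omega;\mathbb R^m),\ v_\varepsilon\to u\text{ in }L^p(\Omega;\mathbb R^m)\Big\},$$ $$\mathcal F_0^{\mathfrak D}(u;O):=\inf\Big\{\liminf_{\varepsilon\to0}F(v_\varepsilon;O): v_\varepsilon\in u+W^{1,p}_0(O;\mathbb R^m),\ v_\varepsilon\to u\text{ in }L^p(\Omega;\mathbb R^m)\Big\}.$$ **Proposition.** Let $O\in\mathcal O(\Omega)$ and $u\in W^{1,p}(\Omega;\mathbb R^m)$. Assume that $u\in \mathrm M_F(O)$, i.e. there is a finite Borel measure $\mu_u$ on $O$, absolutely continuous with respect to $\lambda$, with $m(u;V)\le\mu_u(V)$ for every open $V\subset O$, and that (H0) $\displaystyle\liminf_{\rho\to0}\frac{m(u_x;Q_\rho(x))}{\rho^d}\ge\limsup_{\rho\to0}\frac{m(u_x;Q_\rho(x))}{\rho^d}$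 for a.e. $x\in O$; (H1) for every family $(u_\varepsilon)_{\varepsilon\in]0,1]}\subset W^{1,p}(\Omega;\mathbb R^m)$ with $u_\varepsilon\to u$ in $L^p(\Omega;\mathbb R^m)$ as $\varepsilon\to0$ and $\sup_{\varepsilon}F(u_\varepsilon;O)<\infty$, one has $\displaystyle\limsup_{\rho\to0}\liminf_{\varepsilon\to0}\frac{F(u_\varepsilon;Q_\rho(x))}{\rho^d}\ge\liminf_{\rho\to0}\frac{m(u_x;Q_\rho(x))}{\rho^d}$ for a.e. $x\in O$; (H2) $\displaystyle\limsup_{\rho\to0}\frac{m(u_x;Q_\rho(x))}{\rho^d}\ge\liminf_{\rho\to0}\frac{m(u;Q_\rho(x))}{\rho^d}$ for a.e. $x\in O$. Then the limit $\lim_{\rho\to0}m(u_x;Q_\rho(x))/\rho^d$ exists in $[0,\infty]$ for a.e. $x\in O$, is a Lebesgue measurable function of $x\in O$, and $$\mathcal F_0(u;O)=\mathcal F_0^{\mathfrak D}(u;O)=\int_O\lim_{\rho\to0}\frac{m(u_x;Q_\rho(x))}{\rho^d}\,dx .$$ -/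

import Mathlib

open MeasureTheory Filter Set TopologicalSpace
open scoped ENNReal Topology ContDiff Distributions

noncomputable section

namespace Relaxation

/-- `ℝⁿ` with its Euclidean norm. -/
abbrev Euc (n : ℕ) : Type := EuclideanSpace ℝ (Fin n)

variable {d m : ℕ} {Ω : Opens (Euc d)} {p : ℝ≥0∞}

/-- `L^p(Ω; ℝᵐ)`. -/
abbrev LpFun (Ω : Opens (Euc d)) (m : ℕ) (p : ℝ≥0∞) : Type :=
  Lp (Euc m) p (volume.restrict (Ω : Set (Euc d)))

/-- `L^p(Ω; 𝕄^{m×d})`, matrices being identified with linear maps `ℝᵈ → ℝᵐ`. -/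
abbrev LpGrad (Ω : Opens (Euc d)) (m : ℕ) (p : ℝ≥0∞) : Type :=
  Lp (Euc d →L[ℝ] Euc m) p (volume.restrict (Ω : Set (Euc d)))

/-- `G` is the weak (distributional) gradient of `u` in the open set `Ω`. -/
def IsWeakGradient (Ω : Opens (Euc d)) (u : Euc d → Euc m)
    (G : Euc d → (Euc d →L[ℝ] Euc m)) : Prop :=
  ∀ (φ : 𝓓(Ω, ℝ)) (e : Euc d),
    ∫ x in (Ω : Set (Euc d)), (fderiv ℝ φ x e) • u x
      = - ∫ x in (Ω : Set (Euc d)), φ x • G x e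

/-- The Sobolev space `W^{1,p}(Ω; ℝᵐ)`: an element is a class `val ∈ L^p` together with its
(unique) weak gradient `grad ∈ L^p`. -/
@[ext]
structure W1p (Ω : Opens (Euc d)) (m : ℕ) (p : ℝ≥0∞) where
  val : LpFun Ω m p
  grad : LpGrad Ω m p
  isWeakGradient : IsWeakGradient Ω val grad

/-- `W^{1,p}_0(V; ℝᵐ)` as a subset of `W^{1,p}(Ω; ℝᵐ)`, for `V ⊆ Ω` open: the closure, for the
`W^{1,p}(Ω)` topology, of the smooth functions with compact support in `V`. An element is
represented by the pair (function, gradient). -/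
def W1pZero (Ω : Opens (Euc d)) (m : ℕ) (p : ℝ≥0∞) [Fact (1 ≤ p)] (V : Opens (Euc d)) :
    Set (LpFun Ω m p × LpGrad Ω m p) :=
  closure {z | ∃ φ : 𝓓(V, Euc m),
    (z.1 : Euc d → Euc m) =ᵐ[volume.restrict (Ω : Set (Euc d))] φ ∧
    (z.2 : Euc d → (Euc d →L[ℝ] Euc m)) =ᵐ[volume.restrict (Ω : Set (Euc d))] fderiv ℝ φ}

/-- `v ∈ g + W^{1,p}_0(V; ℝᵐ)`. Here `g` is a function representing an element of
`W^{1,p}(Ω; ℝᵐ)` (a representative of a Sobolev class or an affine map). -/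
def InDirichletClass [Fact (1 ≤ p)] (V : Opens (Euc d)) (g : Euc d → Euc m) (v : W1p Ω m p) :
    Prop :=
  ∃ z ∈ W1pZero Ω m p V,
    (v.val : Euc d → Euc m) =ᵐ[volume.restrict (Ω : Set (Euc d))] fun y => g y + z.1 y

/-- Functionals `W^{1,p}(Ω; ℝᵐ) × 𝒪(Ω) → [0,∞]`. Only the values at open sets `V ≤ Ω` matter. -/
abbrev Functional (Ω : Opens (Euc d)) (m : ℕ) (p : ℝ≥0∞) : Type :=
  W1p Ω m p → Opens (Euc d) → ℝ≥0∞

/-- The class `ℐ(p, α)`: `p`-coercive local functionals which are, in the set variable, traces on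
the open subsets of `Ω` of Borel measures absolutely continuous with respect to Lebesgue
measure. The last two properties are required for all Sobolev functions, also where `F` is
infinite, as is the case for every integral functional. -/
structure IsClassI (α : ℝ) (F : Functional Ω m p) : Prop where
  coercive : ∀ V ≤ Ω, ∀ u : W1p Ω m p,
    ENNReal.ofReal α * ∫⁻ x in (V : Set (Euc d)), ‖u.grad x‖ₑ ^ p.toReal ≤ F u V
  measure : ∀ u : W1p Ω m p, ∃ μ : Measure (Euc d),
    μ ≪ volume.restrict (Ω : Set (Euc d)) ∧ ∀ V ≤ Ω, F u V = μ V
  isLocal : ∀ V ≤ Ω, ∀ u v : W1p Ω m p,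
    (u.val : Euc d → Euc m) =ᵐ[volume.restrict (V : Set (Euc d))] v.val → F u V = F v V

/-- The local Dirichlet infimum `m(g; V) = inf {F(v; V) : v ∈ g + W^{1,p}_0(V; ℝᵐ)}`. -/
def dirichletInf [Fact (1 ≤ p)] (F : Functional Ω m p) (g : Euc d → Euc m)
    (V : Opens (Euc d)) : ℝ≥0∞ :=
  ⨅ (v : W1p Ω m p) (_ : InDirichletClass V g v), F v V

/-- `m₊(g; V) = limsup_{ε → 0} m_ε(g; V)` for a family `𝓕 = (F_ε)`. -/
def mPlus [Fact (1 ≤ p)] (𝓕 : ℝ → Functional Ω m p) (g : Euc d → Euc m)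
    (V : Opens (Euc d)) : ℝ≥0∞ :=
  limsup (fun ε => dirichletInf (𝓕 ε) g V) (𝓝[>] (0 : ℝ))

/-- `m₋(g; V) = liminf_{ε → 0} m_ε(g; V)` for a family `𝓕 = (F_ε)`. -/
def mMinus [Fact (1 ≤ p)] (𝓕 : ℝ → Functional Ω m p) (g : Euc d → Euc m)
    (V : Opens (Euc d)) : ℝ≥0∞ :=
  liminf (fun ε => dirichletInf (𝓕 ε) g V) (𝓝[>] (0 : ℝ))

/-- The set `M_𝓕(O)` of those `u ∈ W^{1,p}(Ω; ℝᵐ)` for which `sup_{0<ε≤1} m_ε(u; ·)` is dominated,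
on the open subsets of `O`, by a finite Borel measure on `O` absolutely continuous with respect
to Lebesgue measure. -/
def MSet [Fact (1 ≤ p)] (𝓕 : ℝ → Functional Ω m p) (O : Opens (Euc d)) : Set (W1p Ω m p) :=
  {u | ∃ μ : Measure (Euc d), IsFiniteMeasure μ ∧ μ ≪ volume.restrict (O : Set (Euc d)) ∧
    ∀ V ≤ O, (⨆ ε ∈ Ioc (0 : ℝ) 1, dirichletInf (𝓕 ε) u.val V) ≤ μ V}

/-- The open cube `Q_ρ(x) = x + ρ ]-1/2, 1/2[ᵈ` with centre `x` and side `ρ`. -/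
def cube (ρ : ℝ) (x : Euc d) : Opens (Euc d) where
  carrier := {y | ∀ i, |y i - x i| < ρ / 2}
  is_open' := by
    simp only [ofPred_forall]
    exact isOpen_iInter_of_finite fun i => isOpen_lt (by fun_prop) continuous_const

/-- The affine tangent map `u_x(y) = u(x) + ∇u(x)(y - x)`. -/
def tangentMap (u : W1p Ω m p) (x : Euc d) : Euc d → Euc m :=
  fun y => u.val x + u.grad x (y - x)

/-- Condition (H0) at `u` on `O`. -/
def CondH0 [Fact (1 ≤ p)] (𝓕 : ℝ → Functional Ω m p) (O : Opens (Euc d)) (u : W1p Ω m p) :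
    Prop :=
  ∀ᵐ x ∂volume.restrict (O : Set (Euc d)),
    limsup (fun ρ : ℝ => mPlus 𝓕 (tangentMap u x) (cube ρ x) / ENNReal.ofReal (ρ ^ d)) (𝓝[>] 0)
      ≤ liminf (fun ρ : ℝ => mMinus 𝓕 (tangentMap u x) (cube ρ x) / ENNReal.ofReal (ρ ^ d)) (𝓝[>] 0)

/-- Condition (H1) at `u` on `O`. The null set may depend on the family `w`. -/
def CondH1 [Fact (1 ≤ p)] (𝓕 : ℝ → Functional Ω m p) (O : Opens (Euc d)) (u : W1p Ω m p) :
    Prop :=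
  ∀ w : ℝ → W1p Ω m p, Tendsto (fun ε => (w ε).val) (𝓝[>] 0) (𝓝 u.val) →
    (⨆ ε ∈ Ioc (0 : ℝ) 1, 𝓕 ε (w ε) O) < ⊤ →
    ∀ᵐ x ∂volume.restrict (O : Set (Euc d)),
      liminf (fun ρ : ℝ => mMinus 𝓕 (tangentMap u x) (cube ρ x) / ENNReal.ofReal (ρ ^ d)) (𝓝[>] 0)
        ≤ limsup (fun ρ : ℝ =>
            liminf (fun ε : ℝ => 𝓕 ε (w ε) (cube ρ x) / ENNReal.ofReal (ρ ^ d)) (𝓝[>] 0)) (𝓝[>] 0)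

/-- Condition (H2) at `u` on `O`. -/
def CondH2 [Fact (1 ≤ p)] (𝓕 : ℝ → Functional Ω m p) (O : Opens (Euc d)) (u : W1p Ω m p) :
    Prop :=
  ∀ᵐ x ∂volume.restrict (O : Set (Euc d)),
    liminf (fun ρ : ℝ => mPlus 𝓕 u.val (cube ρ x) / ENNReal.ofReal (ρ ^ d)) (𝓝[>] 0)
      ≤ limsup (fun ρ : ℝ => mPlus 𝓕 (tangentMap u x) (cube ρ x) / ENNReal.ofReal (ρ ^ d)) (𝓝[>] 0)

/-- The relaxation
`𝓕₀(u; O) = inf {liminf_{ε → 0} F(v_ε; O) : v_ε ∈ W^{1,p}(Ω; ℝᵐ), v_ε → u in L^p(Ω; ℝᵐ)}`. -/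
def relaxation [Fact (1 ≤ p)] (F : Functional Ω m p) (u : W1p Ω m p) (O : Opens (Euc d)) :
    ℝ≥0∞ :=
  ⨅ (v : ℝ → W1p Ω m p) (_ : Tendsto (fun ε => (v ε).val) (𝓝[>] 0) (𝓝 u.val)),
    liminf (fun ε => F (v ε) O) (𝓝[>] (0 : ℝ))

/-- The Dirichlet-constrained relaxation `𝓕₀^𝔇(u; O)`: as `relaxation`, with the infimum over
families with `v_ε ∈ u + W^{1,p}_0(O; ℝᵐ)`. -/
def dirichletRelaxation [Fact (1 ≤ p)] (F : Functional Ω m p) (u : W1p Ω m p)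
    (O : Opens (Euc d)) : ℝ≥0∞ :=
  ⨅ (v : ℝ → W1p Ω m p) (_ : (∀ ε, InDirichletClass O u.val (v ε)) ∧
      Tendsto (fun ε => (v ε).val) (𝓝[>] 0) (𝓝 u.val)),
    liminf (fun ε => F (v ε) O) (𝓝[>] (0 : ℝ))

end Relaxation

end

noncomputable section

namespace Relaxation

/-! Let `g(x)` be the lower density, as `ρ → 0`, of `m(u; Q_ρ(x)) / ρ^d`. Its measurability is not
known, so the proof works with a measurable minorant `G ≤ g` having the same lower integral
(`exists_measurable_minorant_density`). The measure from `M_F(O)` makes this integral finite, and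
maximality of `G` says that `{g ≤ G + β}` has full outer measure in `O` for each `β > 0`. That
suffices for a Vitali covering by disjoint small cubes centred in this set.

On the cubes of such a covering, almost optimal competitors for `m(u; ·)` are glued. On the small
remainder, `m(u; ·)` is dominated by the measure. Poincaré's inequality on small cubes together with
coercivity gives `w_ε → u` in `L^p`. The energies satisfy `F(w_ε; V) ≤ ∫ G + ε`, with the integral
over the `ε`-thickening of `V`, for every open `V ⊆ O` (`exists_recovery`). Taking `V = O` gives the
upper bound for the Dirichlet relaxation.

Because the bound is local, the energy density of `(w_ε)` is at most `G` a.e.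
(`ae_limsup_density_le`). Applying (H1) to this very family closes a loop: a.e. in `O`, `G ≤ g ≤
limsup m(u_x; Q_ρ)/ρ^d ≤ liminf m(u_x; Q_ρ)/ρ^d ≤ G`, by (H2), (H0) and (H1). So the limit exists
and equals the measurable function `G`.

For an arbitrary family of bounded energy, (H1) now bounds its density below by `G`, and a second
Vitali covering integrates this (`lintegral_le_liminf_of_le_density`). Hence `∫_O G` is at most the
relaxation, which is at most the Dirichlet relaxation. -/

/-- The closed cube with centre `x` and side `ρ`. -/
def closedCube {d : ℕ} (ρ : ℝ) (x : Euc d) : Set (Euc d) := {y | ∀ i, |y i - x i| ≤ ρ / 2}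

/-! ### Cubes, differentiation and Vitali coverings -/

section Cubes

variable {d : ℕ}

lemma isClosed_closedCube (ρ : ℝ) (x : Euc d) : IsClosed (closedCube ρ x) := by
  simp only [closedCube, ofPred_forall]
  exact isClosed_iInter fun i => isClosed_le (by fun_prop) continuous_const

lemma cube_subset_closedCube (ρ : ℝ) (x : Euc d) : (cube ρ x : Set (Euc d)) ⊆ closedCube ρ x :=
  fun _ hy i => (hy i).le

lemma mem_cube_self {ρ : ℝ} (hρ : 0 < ρ) (x : Euc d) : x ∈ cube ρ x := fun i => by simpa using hρ

lemma volume_closedCube {ρ : ℝ} (hρ : 0 ≤ ρ) (x : Euc d) :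
    volume (closedCube ρ x) = ENNReal.ofReal (ρ ^ d) := by
  have h : closedCube ρ x = (WithLp.ofLp : Euc d → (Fin d → ℝ)) ⁻¹'
      (univ.pi fun i => Icc (x i - ρ / 2) (x i + ρ / 2)) := by
    ext y
    simp only [closedCube, mem_preimage, mem_univ_pi, mem_Icc, abs_le]
    exact forall_congr' fun i => ⟨fun h => ⟨by linarith, by linarith⟩,
      fun h => ⟨by linarith, by linarith⟩⟩
  rw [h, (PiLp.volume_preserving_ofLp (Fin d)).measure_preimage
    (MeasurableSet.univ_pi fun i => measurableSet_Icc).nullMeasurableSet, volume_pi_pi]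
  simp [Real.volume_Icc, ENNReal.ofReal_pow hρ, show ∀ a : ℝ, a + ρ / 2 - (a - ρ / 2) = ρ by
    intro a; ring]

lemma volume_cube {ρ : ℝ} (hρ : 0 ≤ ρ) (x : Euc d) :
    volume (cube ρ x : Set (Euc d)) = ENNReal.ofReal (ρ ^ d) := by
  have h : (cube ρ x : Set (Euc d)) = (WithLp.ofLp : Euc d → (Fin d → ℝ)) ⁻¹'
      (univ.pi fun i => Ioo (x i - ρ / 2) (x i + ρ / 2)) := by
    ext y
    simp only [cube, Opens.coe_mk, mem_preimage, mem_univ_pi, mem_Ioo, abs_lt]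
    exact forall_congr' fun i => ⟨fun h => ⟨by linarith, by linarith⟩,
      fun h => ⟨by linarith, by linarith⟩⟩
  rw [h, (PiLp.volume_preserving_ofLp (Fin d)).measure_preimage
    (MeasurableSet.univ_pi fun i => measurableSet_Ioo).nullMeasurableSet, volume_pi_pi]
  simp [Real.volume_Ioo, ENNReal.ofReal_pow hρ, show ∀ a : ℝ, a + ρ / 2 - (a - ρ / 2) = ρ by
    intro a; ring]

/-- Vitali coverings use closed cubes, Dirichlet problems open ones. For absolutely continuous
measures the passage between them costs nothing. -/
lemma volume_closedCube_diff_cube {ρ : ℝ} (hρ : 0 ≤ ρ) (x : Euc d) :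
    volume (closedCube ρ x \ cube ρ x) = 0 := by
  rw [measure_sdiff (cube_subset_closedCube ρ x) (cube ρ x).isOpen.nullMeasurableSet
    (by simp [volume_cube hρ]), volume_closedCube hρ, volume_cube hρ, tsub_self]

lemma closedCube_subset_closedBall (hd : 1 ≤ d) {ρ : ℝ} (hρ : 0 ≤ ρ) (x : Euc d) :
    closedCube ρ x ⊆ Metric.closedBall x (d * ρ) := by
  intro y hy
  have hd' : (1 : ℝ) ≤ d := by exact_mod_cast hd
  rw [Metric.mem_closedBall, dist_eq_norm, EuclideanSpace.norm_eq]
  apply Real.sqrt_le_iff.2 ⟨by positivity, ?_⟩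
  calc ∑ i, ‖(y - x) i‖ ^ 2 ≤ ∑ _i : Fin d, ρ ^ 2 := by
        refine Finset.sum_le_sum fun i _ => pow_le_pow_left₀ (norm_nonneg _) ?_ 2
        have := hy i
        simp only [PiLp.sub_apply, Real.norm_eq_abs]
        linarith
    _ = d * ρ ^ 2 := by simp
    _ ≤ (d * ρ) ^ 2 := by nlinarith [sq_nonneg ρ]

lemma closedBall_subset_closedCube (r : ℝ) (x : Euc d) :
    Metric.closedBall x r ⊆ closedCube (2 * r) x := by
  intro y hy i
  rw [Metric.mem_closedBall, dist_eq_norm] at hy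
  have := PiLp.norm_apply_le (y - x) i
  simp only [PiLp.sub_apply, Real.norm_eq_abs] at this
  linarith

/-- The ball sits in a cube of side `6dρ`, whence the constant. The factor 3 is the enlargement
demanded by the Vitali covering theorem. -/
lemma volume_closedBall_le_mul_closedCube {ρ : ℝ} (hρ : 0 ≤ ρ) (x : Euc d) :
    volume (Metric.closedBall x (3 * (d * ρ)))
      ≤ ((6 * d : NNReal) ^ d : NNReal) * volume (closedCube ρ x) := by
  refine (measure_mono (closedBall_subset_closedCube _ x)).trans ?_
  rw [volume_closedCube (by positivity), volume_closedCube hρ,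
    show (2 * (3 * (d * ρ))) ^ d = (6 * d : ℝ) ^ d * ρ ^ d by rw [← mul_pow]; ring,
    ENNReal.ofReal_mul (by positivity)]
  gcongr
  rw [← ENNReal.ofReal_coe_nnreal]
  push_cast
  rfl

/-- A Vitali family for the Lebesgue measure that contains all closed cubes. -/
def cubeVitali (hd : 1 ≤ d) : VitaliFamily (volume : Measure (Euc d)) :=
  Vitali.vitaliFamily volume ((6 * d : NNReal) ^ d) fun x => by
    refine Eventually.frequently ?_
    filter_upwards [self_mem_nhdsWithin] with r (hr : 0 < r)
    have hd' : (0 : ℝ) < d := by exact_mod_cast hd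
    -- With side `r / d` the cube fits in the ball of radius `r`, so the cube estimate gives the
    -- doubling bound for balls.
    have h := volume_closedBall_le_mul_closedCube (ρ := r / d) (by positivity) x
    have h' := closedCube_subset_closedBall hd (ρ := r / d) (by positivity) x
    rw [mul_div_cancel₀ _ hd'.ne'] at h h'
    exact h.trans (by gcongr)

lemma closedCube_mem_setsAt (hd : 1 ≤ d) {ρ : ℝ} (hρ : 0 < ρ) (x : Euc d) :
    closedCube ρ x ∈ (cubeVitali hd).setsAt x :=
  ⟨isClosed_closedCube ρ x,
    ⟨x, interior_maximal (cube_subset_closedCube ρ x) (cube ρ x).isOpen (mem_cube_self hρ x)⟩,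
    d * ρ, closedCube_subset_closedBall hd hρ.le x, volume_closedBall_le_mul_closedCube hρ.le x⟩

lemma eventually_closedCube_subset_closedBall (hd : 1 ≤ d) (x : Euc d) {ε : ℝ} (hε : 0 < ε) :
    ∀ᶠ ρ in 𝓝[>] (0 : ℝ), closedCube ρ x ⊆ Metric.closedBall x ε := by
  have hd' : (0 : ℝ) < d := by exact_mod_cast hd
  filter_upwards [Ioo_mem_nhdsGT (show (0 : ℝ) < ε / d by positivity)] with ρ hρ
  refine (closedCube_subset_closedBall hd hρ.1.le x).trans (Metric.closedBall_subset_closedBall ?_)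
  have := hρ.2.le
  rw [le_div_iff₀ hd'] at this
  linarith

lemma eventually_closedCube_subset (hd : 1 ≤ d) {O : Set (Euc d)} (hO : IsOpen O) {x : Euc d}
    (hx : x ∈ O) : ∀ᶠ ρ in 𝓝[>] (0 : ℝ), closedCube ρ x ⊆ O := by
  obtain ⟨ε, hε, h⟩ := Metric.nhds_basis_closedBall.mem_iff.1 (hO.mem_nhds hx)
  exact (eventually_closedCube_subset_closedBall hd x hε).mono fun ρ hρ => hρ.trans h

lemma tendsto_closedCube_filterAt (hd : 1 ≤ d) (x : Euc d) :
    Tendsto (fun ρ => closedCube ρ x) (𝓝[>] 0) ((cubeVitali hd).filterAt x) := by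
  rw [VitaliFamily.tendsto_filterAt_iff]
  refine ⟨?_, fun ε hε => eventually_closedCube_subset_closedBall hd x hε⟩
  filter_upwards [self_mem_nhdsWithin] with ρ hρ using closedCube_mem_setsAt hd hρ x

/-- Lebesgue differentiation along closed cubes. -/
lemma ae_tendsto_lintegral_closedCube (hd : 1 ≤ d) {f : Euc d → ℝ≥0∞} (hf : AEMeasurable f)
    (hf' : ∫⁻ y, f y ≠ ⊤) :
    ∀ᵐ x : Euc d, Tendsto
      (fun ρ : ℝ => (∫⁻ y in closedCube ρ x, f y) / ENNReal.ofReal (ρ ^ d)) (𝓝[>] 0)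
      (𝓝 (f x)) := by
  filter_upwards [(cubeVitali hd).ae_tendsto_lintegral_div hf hf'] with x hx
  refine (hx.comp (tendsto_closedCube_filterAt hd x)).congr' ?_
  filter_upwards [self_mem_nhdsWithin] with ρ (hρ : 0 < ρ)
  simp [volume_closedCube hρ.le]

/-- Differentiation of measures along closed cubes. -/
lemma ae_tendsto_measure_closedCube (hd : 1 ≤ d) (μ : Measure (Euc d)) [IsFiniteMeasure μ] :
    ∀ᵐ x : Euc d, Tendsto (fun ρ : ℝ => μ (closedCube ρ x) / ENNReal.ofReal (ρ ^ d)) (𝓝[>] 0)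
      (𝓝 (μ.rnDeriv volume x)) := by
  filter_upwards [(cubeVitali hd).ae_tendsto_rnDeriv μ] with x hx
  refine (hx.comp (tendsto_closedCube_filterAt hd x)).congr' ?_
  filter_upwards [self_mem_nhdsWithin] with ρ (hρ : 0 < ρ)
  simp [volume_closedCube hρ.le]

/-- Vitali covering by finitely many disjoint closed cubes, up to small measure. The centres are
taken in a possibly non-measurable set `S` of full outer measure in `O`. -/
lemma exists_finset_disjoint_closedCube (hd : 1 ≤ d) {O : Set (Euc d)} (hO : IsOpen O)
    {S : Set (Euc d)} (hSO : S ⊆ O)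
    (hS : ∀ A ⊆ O, MeasurableSet A → volume (S ∩ A) = 0 → volume A = 0)
    {P : ℝ → Euc d → Prop} (hP : ∀ x ∈ S, ∃ᶠ ρ in 𝓝[>] 0, P ρ x)
    (ν : Measure (Euc d)) [IsFiniteMeasure ν] (hν : ν ≪ volume)
    {η : ℝ≥0∞} (hη : 0 < η) {δ : ℝ} (hδ : 0 < δ) :
    ∃ T : Finset (ℝ × Euc d),
      (∀ q ∈ T, 0 < q.1 ∧ q.1 < δ ∧ P q.1 q.2 ∧ closedCube q.1 q.2 ⊆ O) ∧
      (T : Set (ℝ × Euc d)).PairwiseDisjoint (fun q => closedCube q.1 q.2) ∧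
      ν (O \ ⋃ q ∈ T, closedCube q.1 q.2) ≤ η := by
  set f : Euc d → Set (Set (Euc d)) := fun x =>
    {a | ∃ ρ, 0 < ρ ∧ ρ < δ ∧ P ρ x ∧ closedCube ρ x ⊆ O ∧ a = closedCube ρ x} with hf
  have hfine : (cubeVitali hd).FineSubfamilyOn f S := by
    intro x hx ε hε
    obtain ⟨ρ, h1, h2, h3, h4⟩ := ((hP x hx).and_eventually
      ((eventually_mem_set.2 (Ioo_mem_nhdsGT hδ)).and
        ((eventually_closedCube_subset hd hO (hSO hx)).and
          (eventually_closedCube_subset_closedBall hd x hε)))).exists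
    exact ⟨closedCube ρ x, ⟨closedCube_mem_setsAt hd h2.1 x, ρ, h2.1, h2.2, h1, h3, rfl⟩, h4⟩
  set t := hfine.index
  have htc : t.Countable := hfine.index_countable
  have hcov : ∀ q ∈ t, ∃ ρ, 0 < ρ ∧ ρ < δ ∧ P ρ q.1 ∧ closedCube ρ q.1 ⊆ O ∧
      q.2 = closedCube ρ q.1 := fun q hq => hfine.covering_mem hq
  choose! r hr using hcov
  -- The uncovered part is measurable and meets `S` in a null set, so fullness of `S` makes it null
  -- although `S` need not be measurable.
  have hOt : ν (O \ ⋃ q ∈ t, q.2) = 0 := by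
    refine hν (hS _ sdiff_subset (hO.measurableSet.diff (MeasurableSet.biUnion htc fun q hq =>
      hfine.measurableSet_u hq)) ?_)
    refine measure_mono_null ?_ hfine.measure_sdiff_biUnion
    rintro y ⟨hyS, -, hy⟩
    exact ⟨hyS, hy⟩
  have hsum : ∑' q : t, ν (q : Euc d × Set (Euc d)).2 ≠ ⊤ := by
    have := measure_biUnion (μ := ν) htc hfine.covering_disjoint fun q hq => hfine.measurableSet_u hq
    exact ne_of_eq_of_ne this.symm (measure_ne_top _ _)
  -- Disjointness and finiteness of `ν` make the masses summable. Discarding a tail leaves finitely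
  -- many cubes.
  obtain ⟨s, hs⟩ := ((ENNReal.tendsto_tsum_compl_atTop_zero hsum).eventually
    (Iic_mem_nhds hη)).exists
  have hinj : ∀ q ∈ s, ∀ q' ∈ s, q ≠ q' → Disjoint (closedCube (r q) (q : Euc d × Set (Euc d)).1)
      (closedCube (r q') (q' : Euc d × Set (Euc d)).1) := by
    intro q _ q' _ hqq'
    rw [← (hr q q.2).2.2.2.2, ← (hr q' q'.2).2.2.2.2]
    exact hfine.covering_disjoint q.2 q'.2 (fun h => hqq' (Subtype.ext h))
  classical
  refine ⟨s.image fun q : t => (r q, (q : Euc d × Set (Euc d)).1), ?_, ?_, ?_⟩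
  · intro q hq
    obtain ⟨q', hq', rfl⟩ := Finset.mem_image.1 hq
    have := hr q' q'.2
    exact ⟨this.1, this.2.1, this.2.2.1, this.2.2.2.1⟩
  · intro q hq q' hq' hne
    obtain ⟨a, ha, rfl⟩ := Finset.mem_image.1 hq
    obtain ⟨b, hb, rfl⟩ := Finset.mem_image.1 hq'
    exact hinj a ha b hb fun h => hne (by rw [h])
  · have hsub : O \ ⋃ q ∈ s.image fun q : t => (r q, (q : Euc d × Set (Euc d)).1), closedCube q.1 q.2
        ⊆ (O \ ⋃ q ∈ t, q.2) ∪ ⋃ q : {q : t // q ∉ s}, (q : Euc d × Set (Euc d)).2 := by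
      rintro y ⟨hyO, hy⟩
      by_cases hyt : y ∈ ⋃ q ∈ t, q.2
      · right
        simp only [mem_iUnion, exists_prop] at hyt
        obtain ⟨q, hq, hyq⟩ := hyt
        refine mem_iUnion.2 ⟨⟨⟨q, hq⟩, fun hqs => hy ?_⟩, hyq⟩
        refine mem_iUnion₂.2 ⟨_, Finset.mem_image_of_mem _ hqs, ?_⟩
        rw [(hr q hq).2.2.2.2] at hyq
        exact hyq
      · exact Or.inl ⟨hyO, hyt⟩
    have := htc.to_subtype
    calc _ ≤ _ := measure_mono hsub
      _ ≤ _ := measure_union_le _ _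
      _ ≤ 0 + ∑' q : {q : t // q ∉ s}, ν (q : Euc d × Set (Euc d)).2 := by
        rw [hOt]; gcongr; exact measure_iUnion_le _
      _ ≤ η := by rw [zero_add]; exact hs

end Cubes

/-! ### Pairing `L^p` functions with bounded weights -/

section Pairing

variable {X E : Type*} [MeasurableSpace X] [NormedAddCommGroup E] [NormedSpace ℝ E]
  {μ : Measure X} [IsFiniteMeasure μ] {p : ℝ≥0∞} [Fact (1 ≤ p)]

lemma integrable_smul_Lp {ψ : X → ℝ} (hψ : AEStronglyMeasurable ψ μ) {C : ℝ}
    (hC : ∀ x, ‖ψ x‖ ≤ C) (f : Lp E p μ) : Integrable (fun x => ψ x • f x) μ :=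
  ((Lp.memLp f).integrable Fact.out).bdd_smul C hψ (Eventually.of_forall hC)

/-- On a finite measure space `L^p` embeds in `L^1` by Hölder. This allows the weak gradient
identity to pass to `L^p` limits. -/
lemma continuous_integral_smul_Lp {ψ : X → ℝ} (hψ : AEStronglyMeasurable ψ μ) {C : ℝ}
    (hC0 : 0 ≤ C) (hC : ∀ x, ‖ψ x‖ ≤ C) : Continuous fun f : Lp E p μ => ∫ x, ψ x • f x ∂μ := by
  let Λ : Lp E p μ →ₗ[ℝ] E :=
    { toFun := fun f => ∫ x, ψ x • f x ∂μ
      map_add' := fun f g => by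
        rw [← integral_add (integrable_smul_Lp hψ hC f) (integrable_smul_Lp hψ hC g)]
        refine integral_congr_ae ?_
        filter_upwards [Lp.coeFn_add f g] with x hx
        rw [hx, Pi.add_apply, smul_add]
      map_smul' := fun c f => by
        rw [RingHom.id_apply, ← integral_smul]
        refine integral_congr_ae ?_
        filter_upwards [Lp.coeFn_smul c f] with x hx
        rw [hx, Pi.smul_apply, smul_comm] }
  refine (Λ.mkContinuous (C * (μ univ ^ (1 / (1 : ℝ≥0∞).toReal - 1 / p.toReal)).toReal) ?_).continuous
  intro f
  have hf1 : Integrable (fun x => f x) μ := (Lp.memLp f).integrable Fact.out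
  calc ‖∫ x, ψ x • f x ∂μ‖ ≤ ∫ x, C * ‖f x‖ ∂μ := by
        refine norm_integral_le_of_norm_le (hf1.norm.const_mul C) (Eventually.of_forall fun x => ?_)
        rw [norm_smul]
        gcongr
        exact hC x
    _ = C * (eLpNorm f 1 μ).toReal := by
        rw [integral_const_mul, eLpNorm_one_eq_lintegral_enorm,
          integral_norm_eq_lintegral_enorm hf1.1]
    _ ≤ C * (eLpNorm f p μ * μ univ ^ (1 / (1 : ℝ≥0∞).toReal - 1 / p.toReal)).toReal := by
        gcongr
        · refine ENNReal.mul_ne_top (Lp.eLpNorm_ne_top f) (ENNReal.rpow_ne_top_of_nonneg ?_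
            (measure_ne_top _ _))
          rcases eq_or_ne p ⊤ with rfl | hp
          · simp
          · have : 1 ≤ p.toReal := by
              rw [← ENNReal.toReal_one]
              exact ENNReal.toReal_mono hp Fact.out
            simp only [ENNReal.toReal_one, div_one, one_div, sub_nonneg]
            exact inv_le_one_of_one_le₀ this
        · exact eLpNorm_le_eLpNorm_mul_rpow_measure_univ Fact.out (Lp.aestronglyMeasurable f)
    _ = _ := by
        rw [ENNReal.toReal_mul, Lp.norm_def]
        ring

end Pairing

/-! ### The space `W^{1,p}_0(V)` and weak gradients -/

section Zero

variable {d m : ℕ} {Ω : Opens (Euc d)} {p : ℝ≥0∞} [Fact (1 ≤ p)]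

lemma zero_mem_W1pZero (V : Opens (Euc d)) : (0 : LpFun Ω m p × LpGrad Ω m p) ∈ W1pZero Ω m p V := by
  refine subset_closure ⟨0, ?_, ?_⟩
  · exact Lp.coeFn_zero _ _ _
  · refine (Lp.coeFn_zero _ _ _).trans (Eventually.of_forall fun x => ?_)
    have : ((0 : 𝓓(V, Euc m)) : Euc d → Euc m) = 0 := by ext; simp
    simp [this]

lemma add_mem_W1pZero {V : Opens (Euc d)} {z w : LpFun Ω m p × LpGrad Ω m p}
    (hz : z ∈ W1pZero Ω m p V) (hw : w ∈ W1pZero Ω m p V) : z + w ∈ W1pZero Ω m p V := by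
  refine map_mem_closure₂ continuous_add hz hw ?_
  rintro a ⟨φ, h1, h2⟩ b ⟨ψ, h3, h4⟩
  have hadd : ((φ + ψ : 𝓓(V, Euc m)) : Euc d → Euc m) = φ + ψ := by ext; simp
  refine ⟨φ + ψ, ?_, ?_⟩
  · filter_upwards [h1, h3, Lp.coeFn_add a.1 b.1] with x hx1 hx2 hx3
    rw [Prod.fst_add, hx3, hadd, Pi.add_apply, Pi.add_apply, hx1, hx2]
  · filter_upwards [h2, h4, Lp.coeFn_add a.2 b.2] with x hx1 hx2 hx3
    rw [Prod.snd_add, hx3, hadd, Pi.add_apply, hx1, hx2, fderiv_add]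
    · exact (φ.contDiff.differentiable (by simp)).differentiableAt
    · exact (ψ.contDiff.differentiable (by simp)).differentiableAt

lemma W1pZero_mono {V W : Opens (Euc d)} (h : V ≤ W) : W1pZero Ω m p V ⊆ W1pZero Ω m p W := by
  refine closure_mono ?_
  rintro z ⟨φ, h1, h2⟩
  exact ⟨⟨φ, φ.contDiff, φ.hasCompactSupport, φ.tsupport_subset.trans h⟩, h1, h2⟩

lemma sum_mem_W1pZero {ι : Type*} {V : Opens (Euc d)} (s : Finset ι)
    {z : ι → LpFun Ω m p × LpGrad Ω m p} (hz : ∀ i ∈ s, z i ∈ W1pZero Ω m p V) :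
    ∑ i ∈ s, z i ∈ W1pZero Ω m p V :=
  Finset.sum_induction z (· ∈ W1pZero Ω m p V) (fun _ _ => add_mem_W1pZero)
    (zero_mem_W1pZero V) hz

lemma isClosed_ae_eq_zero_restrict {X E : Type*} [MeasurableSpace X] [NormedAddCommGroup E]
    [NormedSpace ℝ E] (μ : Measure X) (A : Set X) :
    IsClosed {f : Lp E p μ | f =ᵐ[μ.restrict A] (0 : X → E)} := by
  have : {f : Lp E p μ | f =ᵐ[μ.restrict A] (0 : X → E)}
      = LpToLpRestrictCLM X E ℝ μ p A ⁻¹' {0} := by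
    ext f
    have h := LpToLpRestrictCLM_coeFn (F := E) (p := p) ℝ A f
    simp only [mem_ofPred_eq, mem_preimage, mem_singleton_iff]
    rw [Lp.eq_zero_iff_ae_eq_zero]
    exact ⟨fun hf => h.trans hf, fun hf => h.symm.trans hf⟩
  rw [this]
  exact isClosed_singleton.preimage (LpToLpRestrictCLM X E ℝ μ p A).continuous

/-- Vanishing off `V` is a closed condition that holds for test functions. It is what keeps
corrections on disjoint open sets from interacting. -/
lemma ae_eq_zero_of_mem_W1pZero {V : Opens (Euc d)} {z : LpFun Ω m p × LpGrad Ω m p}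
    (hz : z ∈ W1pZero Ω m p V) :
    (z.1 : Euc d → Euc m) =ᵐ[(volume.restrict (Ω : Set (Euc d))).restrict (V : Set (Euc d))ᶜ] 0 ∧
    (z.2 : Euc d → (Euc d →L[ℝ] Euc m))
      =ᵐ[(volume.restrict (Ω : Set (Euc d))).restrict (V : Set (Euc d))ᶜ] 0 := by
  refine closure_minimal (t := {z : LpFun Ω m p × LpGrad Ω m p | _ ∧ _}) ?_
    (IsClosed.and ((isClosed_ae_eq_zero_restrict _ _).preimage continuous_fst)
    ((isClosed_ae_eq_zero_restrict _ _).preimage continuous_snd)) hz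
  rintro z ⟨φ, h1, h2⟩
  have hm : MeasurableSet (V : Set (Euc d))ᶜ := V.isOpen.measurableSet.compl
  constructor
  · filter_upwards [ae_restrict_of_ae h1, ae_restrict_mem hm] with x hx hxV
    rw [hx]
    exact image_eq_zero_of_notMem_tsupport fun h => hxV (φ.tsupport_subset h)
  · filter_upwards [ae_restrict_of_ae h2, ae_restrict_mem hm] with x hx hxV
    rw [hx]
    exact image_eq_zero_of_notMem_tsupport fun h =>
      hxV (φ.tsupport_subset (tsupport_fderiv_subset ℝ h))

lemma exists_bound_testFunction {F : Type*} [NormedAddCommGroup F] [NormedSpace ℝ F]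
    {V : Opens (Euc d)} (φ : 𝓓(V, F)) : ∃ C, 0 ≤ C ∧ ∀ x, ‖φ x‖ ≤ C := by
  obtain ⟨C, hC⟩ := φ.continuous.bounded_above_of_compact_support φ.hasCompactSupport
  exact ⟨C, (norm_nonneg _).trans (hC 0), hC⟩

lemma continuous_fderiv_testFunction {F : Type*} [NormedAddCommGroup F] [NormedSpace ℝ F]
    {V : Opens (Euc d)} (φ : 𝓓(V, F)) : Continuous (fderiv ℝ φ) :=
  φ.contDiff.continuous_fderiv (by simp)

lemma exists_bound_fderiv_testFunction {F : Type*} [NormedAddCommGroup F] [NormedSpace ℝ F]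
    {V : Opens (Euc d)} (φ : 𝓓(V, F)) (e : Euc d) :
    ∃ C, 0 ≤ C ∧ ∀ x, ‖fderiv ℝ φ x e‖ ≤ C := by
  obtain ⟨C, hC⟩ := (continuous_fderiv_testFunction φ).bounded_above_of_compact_support
    (φ.hasCompactSupport.fderiv ℝ)
  exact ⟨C * ‖e‖, mul_nonneg ((norm_nonneg _).trans (hC 0)) (norm_nonneg _), fun x =>
    ((fderiv ℝ φ x).le_opNorm e).trans (by gcongr; exact hC x)⟩

lemma isFiniteMeasure_restrict_of_isBounded (hΩ : Bornology.IsBounded (Ω : Set (Euc d))) :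
    IsFiniteMeasure (volume.restrict (Ω : Set (Euc d))) :=
  ⟨by rw [Measure.restrict_apply_univ]; exact hΩ.measure_lt_top⟩

lemma IsWeakGradient.add (hΩ : Bornology.IsBounded (Ω : Set (Euc d))) {f g : LpFun Ω m p}
    {f' g' : LpGrad Ω m p} (hf : IsWeakGradient Ω f f') (hg : IsWeakGradient Ω g g') :
    IsWeakGradient Ω (f + g : LpFun Ω m p) (f' + g' : LpGrad Ω m p) := by
  have := isFiniteMeasure_restrict_of_isBounded hΩ
  intro φ e
  obtain ⟨C, hC0, hC⟩ := exists_bound_testFunction φ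
  obtain ⟨D, hD0, hD⟩ := exists_bound_fderiv_testFunction φ e
  have hφ := ((continuous_fderiv_testFunction φ).clm_apply
    (continuous_const (y := e))).aestronglyMeasurable (μ := volume.restrict (Ω : Set (Euc d)))
  have hφ' := φ.continuous.aestronglyMeasurable (μ := volume.restrict (Ω : Set (Euc d)))
  have key : ∀ G : LpGrad Ω m p, Integrable (fun x => φ x • G x e)
      (volume.restrict (Ω : Set (Euc d))) := fun G =>
    (integrable_smul_Lp hφ' hC G).apply_continuousLinearMap e
  calc _ = ∫ x in (Ω : Set (Euc d)), ((fderiv ℝ φ x e) • f x + (fderiv ℝ φ x e) • g x) := by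
        refine integral_congr_ae ?_
        filter_upwards [Lp.coeFn_add f g] with x hx
        rw [hx, Pi.add_apply, smul_add]
    _ = -(∫ x in (Ω : Set (Euc d)), (φ x • f' x e + φ x • g' x e)) := by
        rw [integral_add (integrable_smul_Lp hφ hD f) (integrable_smul_Lp hφ hD g), hf φ e, hg φ e,
          integral_add (key f') (key g'), neg_add]
    _ = _ := by
        congr 1
        refine integral_congr_ae ?_
        filter_upwards [Lp.coeFn_add f' g'] with x hx
        rw [hx, Pi.add_apply, add_apply, smul_add]

lemma isClosed_isWeakGradient (hΩ : Bornology.IsBounded (Ω : Set (Euc d))) :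
    IsClosed {z : LpFun Ω m p × LpGrad Ω m p | IsWeakGradient Ω z.1 z.2} := by
  have := isFiniteMeasure_restrict_of_isBounded hΩ
  simp only [IsWeakGradient, ofPred_forall]
  refine isClosed_iInter fun φ => isClosed_iInter fun e => ?_
  obtain ⟨C, hC0, hC⟩ := exists_bound_testFunction φ
  obtain ⟨D, hD0, hD⟩ := exists_bound_fderiv_testFunction φ e
  have hφ := ((continuous_fderiv_testFunction φ).clm_apply
    (continuous_const (y := e))).aestronglyMeasurable (μ := volume.restrict (Ω : Set (Euc d)))
  have hφ' := φ.continuous.aestronglyMeasurable (μ := volume.restrict (Ω : Set (Euc d)))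
  refine isClosed_eq ((continuous_integral_smul_Lp hφ hD0 hD).comp continuous_fst) ?_
  have h : Continuous fun z : LpFun Ω m p × LpGrad Ω m p =>
      -(∫ x in (Ω : Set (Euc d)), φ x • z.2 x) e :=
    ((((continuous_integral_smul_Lp hφ' hC0 hC).comp continuous_snd)).clm_apply
      continuous_const).neg
  refine h.congr fun z => ?_
  rw [ContinuousLinearMap.integral_apply (integrable_smul_Lp hφ' hC z.2)]
  rfl

/-- Elements of `W1pZero` are mere pairs. Closedness of the weak gradient relation and integration
by parts for test functions turn them into Sobolev functions, so that they may be added to `u`. -/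
lemma isWeakGradient_of_mem_W1pZero (hΩ : Bornology.IsBounded (Ω : Set (Euc d)))
    {V : Opens (Euc d)} (hV : V ≤ Ω) {z : LpFun Ω m p × LpGrad Ω m p}
    (hz : z ∈ W1pZero Ω m p V) : IsWeakGradient Ω z.1 z.2 := by
  refine closure_minimal ?_ (isClosed_isWeakGradient hΩ) hz
  rintro z ⟨φ, h1, h2⟩ ψ e
  have e1 : ∫ x in (Ω : Set (Euc d)), (fderiv ℝ ψ x e) • z.1 x = ∫ x, (fderiv ℝ ψ x e) • φ x := by
    refine (integral_congr_ae ?_).trans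
      (setIntegral_eq_integral_of_forall_compl_eq_zero (s := (Ω : Set (Euc d))) fun x hx => ?_)
    · filter_upwards [h1] with x hx
      rw [hx]
    · rw [image_eq_zero_of_notMem_tsupport fun h => hx (hV (φ.tsupport_subset h)), smul_zero]
  have e2 : ∫ x in (Ω : Set (Euc d)), ψ x • z.2 x e = ∫ x, ψ x • fderiv ℝ φ x e := by
    refine (integral_congr_ae ?_).trans
      (setIntegral_eq_integral_of_forall_compl_eq_zero (s := (Ω : Set (Euc d))) fun x hx => ?_)
    · filter_upwards [h2] with x hx
      rw [hx]
    · rw [image_eq_zero_of_notMem_tsupport fun h => hx (ψ.tsupport_subset h), zero_smul]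
  rw [e1, e2, integral_smul_fderiv_eq_neg_fderiv_smul_of_integrable, neg_neg]
  · exact (((continuous_fderiv_testFunction ψ).clm_apply continuous_const).smul
      φ.continuous).integrable_of_hasCompactSupport φ.hasCompactSupport.smul_left
  · exact (ψ.continuous.smul ((continuous_fderiv_testFunction φ).clm_apply
      continuous_const)).integrable_of_hasCompactSupport ψ.hasCompactSupport.smul_right
  · exact (ψ.continuous.smul φ.continuous).integrable_of_hasCompactSupport
      φ.hasCompactSupport.smul_left
  · exact fun x _ => (ψ.contDiff.differentiable (by simp)).differentiableAt
  · exact fun x _ => (φ.contDiff.differentiable (by simp)).differentiableAt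

/-- The Sobolev function `u + z`. -/
def W1p.addPair (u : W1p Ω m p) (hΩ : Bornology.IsBounded (Ω : Set (Euc d)))
    (z : LpFun Ω m p × LpGrad Ω m p) (hz : IsWeakGradient Ω z.1 z.2) : W1p Ω m p where
  val := u.val + z.1
  grad := u.grad + z.2
  isWeakGradient := u.isWeakGradient.add hΩ hz

end Zero

/-! ### Poincaré's inequality in a slab -/

section Poincare

lemma enorm_zero_rpow {E : Type*} [NormedAddCommGroup E] {q : ℝ} (hq : 0 < q) :
    ‖(0 : E)‖ₑ ^ q = 0 := by
  rw [enorm_zero, ENNReal.zero_rpow_of_pos hq]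

lemma lintegral_rpow_le_measure_univ_rpow_mul {X : Type*} [MeasurableSpace X] {μ : Measure X}
    {h : X → ℝ≥0∞} (hh : AEMeasurable h μ) {q : ℝ} (hq : 1 ≤ q) :
    (∫⁻ t, h t ∂μ) ^ q ≤ μ univ ^ (q - 1) * ∫⁻ t, h t ^ q ∂μ := by
  have hq0 : 0 < q := by linarith
  have hle : (1 : ℝ≥0∞) ≤ ENNReal.ofReal q := by simpa using hq
  have := eLpNorm_le_eLpNorm_mul_rpow_measure_univ (μ := μ) hle hh.aestronglyMeasurable
  rw [eLpNorm_one_eq_lintegral_enorm, eLpNorm_eq_lintegral_rpow_enorm_toReal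
    (by simpa using hq0) ENNReal.ofReal_ne_top, ENNReal.toReal_ofReal hq0.le] at this
  simp only [enorm_eq_self, ENNReal.toReal_one, div_one] at this
  calc _ ≤ _ := ENNReal.rpow_le_rpow this hq0.le
    _ = _ := by
      rw [ENNReal.mul_rpow_of_nonneg _ _ hq0.le, ← ENNReal.rpow_mul, ← ENNReal.rpow_mul,
        one_div_mul_cancel hq0.ne', ENNReal.rpow_one, mul_comm]
      congr 2
      field_simp

variable {d m : ℕ}

/-- Integrate the derivative along the segment from `x` to `x + ρ e_i`, whose endpoint has left the
slab when `x ∈ V`. -/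
lemma enorm_le_lintegral_of_slab {V : Opens (Euc d)} (φ : 𝓓(V, Euc m)) (i : Fin d) {c ρ : ℝ}
    (hρ : 0 ≤ ρ) (hV : ∀ y ∈ V, |y i - c| < ρ / 2) (x : Euc d) :
    ‖φ x‖ₑ ≤ ∫⁻ t in Ioc 0 ρ, ‖fderiv ℝ φ (x + t • EuclideanSpace.single i (1 : ℝ))‖ₑ := by
  set e : Euc d := EuclideanSpace.single i (1 : ℝ) with he
  have h0 : ∀ y ∉ V, φ y = 0 := fun y hy =>
    image_eq_zero_of_notMem_tsupport fun h => hy (φ.tsupport_subset h)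
  by_cases hx : x ∈ V
  swap
  · simp [h0 x hx]
  have hend : φ (x + ρ • e) = 0 := by
    refine h0 _ fun h => ?_
    have h1 := abs_lt.1 (hV _ h)
    have h2 := abs_lt.1 (hV _ hx)
    simp only [he, PiLp.add_apply, PiLp.smul_apply, PiLp.single_apply, if_true,
      smul_eq_mul, mul_one] at h1
    linarith
  have hderiv : ∀ t : ℝ, HasDerivAt (fun t : ℝ => φ (x + t • e)) (fderiv ℝ φ (x + t • e) e) t := by
    intro t
    have hl : HasDerivAt (fun t : ℝ => x + t • e) e t := by
      simpa using ((hasDerivAt_id t).smul_const e).const_add x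
    exact ((φ.contDiff.differentiable (by simp)).differentiableAt.hasFDerivAt).comp_hasDerivAt t hl
  have hcont : Continuous fun t : ℝ => fderiv ℝ φ (x + t • e) e :=
    ((continuous_fderiv_testFunction φ).comp (by fun_prop)).clm_apply continuous_const
  have hint := intervalIntegral.integral_eq_sub_of_hasDerivAt (a := 0) (b := ρ)
    (fun t _ => hderiv t) (hcont.intervalIntegrable 0 ρ)
  rw [hend, zero_smul, add_zero, zero_sub, intervalIntegral.integral_of_le hρ] at hint
  rw [← enorm_neg, ← hint]
  refine (enorm_integral_le_lintegral_enorm _).trans (lintegral_mono fun t => ?_)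
  refine ((fderiv ℝ φ (x + t • e)).le_opENorm e).trans (le_of_eq ?_)
  have : ‖e‖ₑ = 1 := by rw [← ofReal_norm]; simp [he]
  rw [this, mul_one]

/-- Hölder on `]0, ρ]` gives the factor `ρ^(q-1)`. Fubini and translation invariance give the
remaining factor `ρ`. -/
lemma lintegral_rpow_le_of_slab {V : Opens (Euc d)} (φ : 𝓓(V, Euc m)) (i : Fin d) {c ρ : ℝ}
    (hρ : 0 ≤ ρ) (hV : ∀ y ∈ V, |y i - c| < ρ / 2) {q : ℝ} (hq : 1 ≤ q) :
    ∫⁻ x, ‖φ x‖ₑ ^ q ≤ ENNReal.ofReal ρ ^ q * ∫⁻ x, ‖fderiv ℝ φ x‖ₑ ^ q := by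
  set e : Euc d := EuclideanSpace.single i (1 : ℝ)
  have hc := continuous_fderiv_testFunction φ
  have hvol : (volume.restrict (Ioc 0 ρ)) univ = ENNReal.ofReal ρ := by simp
  calc ∫⁻ x, ‖φ x‖ₑ ^ q
      ≤ ∫⁻ x, ENNReal.ofReal ρ ^ (q - 1) *
          ∫⁻ t in Ioc 0 ρ, ‖fderiv ℝ φ (x + t • e)‖ₑ ^ q := by
        refine lintegral_mono fun x => ?_
        refine (ENNReal.rpow_le_rpow (enorm_le_lintegral_of_slab φ i hρ hV x)
          (by linarith)).trans ?_
        rw [← hvol]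
        exact lintegral_rpow_le_measure_univ_rpow_mul
          ((hc.comp (by fun_prop : Continuous fun t : ℝ => x + t • e)).enorm.aemeasurable) hq
    _ = ENNReal.ofReal ρ ^ (q - 1) *
          ∫⁻ t in Ioc 0 ρ, ∫⁻ x, ‖fderiv ℝ φ (x + t • e)‖ₑ ^ q := by
        have hm : Measurable (Function.uncurry fun (x : Euc d) (t : ℝ) =>
            ‖fderiv ℝ φ (x + t • e)‖ₑ ^ q) :=
          ((hc.comp (by fun_prop : Continuous fun z : Euc d × ℝ =>
            z.1 + z.2 • e)).enorm.measurable).pow_const q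
        rw [lintegral_const_mul' _ _ (ENNReal.rpow_ne_top_of_nonneg (by linarith)
          ENNReal.ofReal_ne_top), lintegral_lintegral_swap hm.aemeasurable]
    _ = ENNReal.ofReal ρ ^ (q - 1) * (ENNReal.ofReal ρ * ∫⁻ x, ‖fderiv ℝ φ x‖ₑ ^ q) := by
        congr 1
        rw [← hvol, mul_comm, ← lintegral_const]
        refine lintegral_congr fun t => ?_
        exact lintegral_add_right_eq_self (fun x => ‖fderiv ℝ φ x‖ₑ ^ q) (t • e)
    _ = _ := by
        rw [← mul_assoc]
        congr 1
        nth_rw 2 [← ENNReal.rpow_one (ENNReal.ofReal ρ)]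
        rw [← ENNReal.rpow_add_of_nonneg _ _ (by linarith) zero_le_one, sub_add_cancel]

variable {Ω : Opens (Euc d)} {p : ℝ≥0∞} [Fact (1 ≤ p)]

lemma one_le_toReal_exponent (hp : p ≠ ⊤) : 1 ≤ p.toReal := by
  rw [← ENNReal.toReal_one]
  exact ENNReal.toReal_mono hp Fact.out

lemma enorm_Lp_rpow {X E : Type*} [MeasurableSpace X] [NormedAddCommGroup E] {μ : Measure X}
    (hp : p ≠ ⊤) (f : Lp E p μ) : ‖f‖ₑ ^ p.toReal = ∫⁻ x, ‖f x‖ₑ ^ p.toReal ∂μ := by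
  have h1 := one_le_toReal_exponent hp
  have h0 : p ≠ 0 := by rintro rfl; simp at h1; linarith
  rw [Lp.enorm_def, eLpNorm_eq_lintegral_rpow_enorm_toReal h0 hp, ← ENNReal.rpow_mul,
    one_div_mul_cancel (by linarith), ENNReal.rpow_one]

/-- Poincaré's inequality in `W^{1,p}_0(V)` when `V` lies in a slab of width `ρ`. -/
lemma enorm_fst_le_of_slab (hp : p ≠ ⊤) {V : Opens (Euc d)} (hVΩ : V ≤ Ω) (i : Fin d) {c ρ : ℝ}
    (hρ : 0 ≤ ρ) (hV : ∀ y ∈ V, |y i - c| < ρ / 2) {z : LpFun Ω m p × LpGrad Ω m p}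
    (hz : z ∈ W1pZero Ω m p V) : ‖z.1‖ₑ ≤ ENNReal.ofReal ρ * ‖z.2‖ₑ := by
  have h1 := one_le_toReal_exponent hp
  refine closure_minimal (t := {z : LpFun Ω m p × LpGrad Ω m p | _ ≤ _}) ?_
    (isClosed_le (f := fun z : LpFun Ω m p × LpGrad Ω m p => ‖z.1‖ₑ)
      (g := fun z => ENNReal.ofReal ρ * ‖z.2‖ₑ) continuous_fst.enorm
      (ENNReal.continuous_const_mul ENNReal.ofReal_ne_top |>.comp continuous_snd.enorm)) hz
  rintro z ⟨φ, hz1, hz2⟩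
  change ‖z.1‖ₑ ≤ ENNReal.ofReal ρ * ‖z.2‖ₑ
  rw [← ENNReal.rpow_le_rpow_iff (z := p.toReal) (by linarith),
    ENNReal.mul_rpow_of_nonneg _ _ (by linarith), enorm_Lp_rpow hp, enorm_Lp_rpow hp]
  calc ∫⁻ x in (Ω : Set (Euc d)), ‖z.1 x‖ₑ ^ p.toReal
      = ∫⁻ x in (Ω : Set (Euc d)), ‖φ x‖ₑ ^ p.toReal :=
        lintegral_congr_ae (hz1.mono fun x hx => by simp only [hx])
    _ ≤ ∫⁻ x, ‖φ x‖ₑ ^ p.toReal := setLIntegral_le_lintegral _ _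
    _ ≤ ENNReal.ofReal ρ ^ p.toReal * ∫⁻ x, ‖fderiv ℝ φ x‖ₑ ^ p.toReal :=
        lintegral_rpow_le_of_slab φ i hρ hV h1
    _ = ENNReal.ofReal ρ ^ p.toReal *
          ∫⁻ x in (Ω : Set (Euc d)), ‖fderiv ℝ φ x‖ₑ ^ p.toReal := by
        rw [setLIntegral_eq_of_support_subset]
        intro x hx
        by_contra hxΩ
        refine hx ?_
        have : fderiv ℝ φ x = 0 := image_eq_zero_of_notMem_tsupport fun h =>
          hxΩ (hVΩ (φ.tsupport_subset (tsupport_fderiv_subset ℝ h)))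
        simp only [this]
        exact enorm_zero_rpow (by linarith)
    _ = _ := by
        congr 1
        exact lintegral_congr_ae (hz2.mono fun x hx => by simp only [hx])

lemma setLIntegral_enorm_rpow_eq_of_ae_eq_zero {E : Type*} [NormedAddCommGroup E] {q : ℝ}
    (hq : 0 < q) {V : Opens (Euc d)} (hVΩ : V ≤ Ω) {f : Euc d → E}
    (hf : f =ᵐ[(volume.restrict (Ω : Set (Euc d))).restrict (V : Set (Euc d))ᶜ] 0) :
    ∫⁻ x in (Ω : Set (Euc d)), ‖f x‖ₑ ^ q = ∫⁻ x in (V : Set (Euc d)), ‖f x‖ₑ ^ q := by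
  have hm := V.isOpen.measurableSet
  rw [← lintegral_add_compl _ hm, Measure.restrict_restrict hm, inter_eq_self_of_subset_left hVΩ]
  have h0 : ∫⁻ x in (V : Set (Euc d))ᶜ, ‖f x‖ₑ ^ q ∂(volume.restrict (Ω : Set (Euc d))) = 0 := by
    rw [lintegral_congr_ae (hf.mono fun x hx =>
      (by simp only [hx]; exact enorm_zero_rpow hq :
        ‖f x‖ₑ ^ q = (fun _ => 0) x)), lintegral_zero]
  rw [h0, add_zero]

/-- Poincaré's inequality in integral form, on the set where `z` lives. -/
lemma lintegral_fst_le_of_slab (hp : p ≠ ⊤) {V : Opens (Euc d)} (hVΩ : V ≤ Ω) (i : Fin d)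
    {c ρ : ℝ} (hρ : 0 ≤ ρ) (hV : ∀ y ∈ V, |y i - c| < ρ / 2)
    {z : LpFun Ω m p × LpGrad Ω m p} (hz : z ∈ W1pZero Ω m p V) :
    ∫⁻ x in (V : Set (Euc d)), ‖z.1 x‖ₑ ^ p.toReal
      ≤ ENNReal.ofReal ρ ^ p.toReal * ∫⁻ x in (V : Set (Euc d)), ‖z.2 x‖ₑ ^ p.toReal := by
  have h1 := one_le_toReal_exponent hp
  have h := ENNReal.rpow_le_rpow (enorm_fst_le_of_slab hp hVΩ i hρ hV hz)
    (show 0 ≤ p.toReal by linarith)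
  rw [ENNReal.mul_rpow_of_nonneg _ _ (by linarith), enorm_Lp_rpow hp, enorm_Lp_rpow hp] at h
  rwa [setLIntegral_enorm_rpow_eq_of_ae_eq_zero (by linarith) hVΩ (ae_eq_zero_of_mem_W1pZero hz).1,
    setLIntegral_enorm_rpow_eq_of_ae_eq_zero (by linarith) hVΩ
      (ae_eq_zero_of_mem_W1pZero hz).2] at h

end Poincare

/-! ### Gluing local competitors -/

section Glue

variable {d m : ℕ} {Ω : Opens (Euc d)} {p : ℝ≥0∞} [Fact (1 ≤ p)]

/-- The other summands belong to `W^{1,p}_0` of the union of the other sets, hence vanish on `V i`.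
-/
lemma ae_eq_sum_of_mem_W1pZero {ι : Type*} {s : Finset ι} {V : ι → Opens (Euc d)}
    (hVΩ : ∀ i ∈ s, V i ≤ Ω) (hdisj : (s : Set ι).PairwiseDisjoint fun i => (V i : Set (Euc d)))
    {z : ι → LpFun Ω m p × LpGrad Ω m p} (hz : ∀ i ∈ s, z i ∈ W1pZero Ω m p (V i))
    {i : ι} (hi : i ∈ s) :
    ((∑ j ∈ s, z j).1 : Euc d → Euc m) =ᵐ[volume.restrict (V i : Set (Euc d))] (z i).1 ∧
    ((∑ j ∈ s, z j).2 : Euc d → (Euc d →L[ℝ] Euc m))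
      =ᵐ[volume.restrict (V i : Set (Euc d))] (z i).2 := by
  classical
  set y := ∑ j ∈ s.erase i, z j with hy
  have hsum : ∑ j ∈ s, z j = z i + y := (Finset.add_sum_erase s z hi).symm
  set W : Opens (Euc d) := ⨆ j ∈ s.erase i, V j with hW
  have hyW : y ∈ W1pZero Ω m p W := sum_mem_W1pZero _ fun j hj =>
    W1pZero_mono (le_iSup₂_of_le j hj le_rfl) (hz j (Finset.mem_of_mem_erase hj))
  have hVW : (V i : Set (Euc d)) ⊆ (W : Set (Euc d))ᶜ := by
    intro x hx hxW
    simp only [hW, Opens.coe_iSup, mem_iUnion] at hxW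
    obtain ⟨j, hj, hxj⟩ := hxW
    exact (hdisj hi (Finset.mem_of_mem_erase hj) (Finset.ne_of_mem_erase hj).symm).le_bot ⟨hx, hxj⟩
  have hle : volume.restrict (V i : Set (Euc d))
      ≤ (volume.restrict (Ω : Set (Euc d))).restrict (W : Set (Euc d))ᶜ := by
    rw [Measure.restrict_restrict W.isOpen.measurableSet.compl]
    exact Measure.restrict_mono_set _ (subset_inter hVW (hVΩ i hi))
  have hle' : volume.restrict (V i : Set (Euc d)) ≤ volume.restrict (Ω : Set (Euc d)) :=
    Measure.restrict_mono_set _ (hVΩ i hi)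
  rw [hsum]
  constructor
  · filter_upwards [ae_mono hle (ae_eq_zero_of_mem_W1pZero hyW).1,
      ae_mono hle' (Lp.coeFn_add (z i).1 y.1)] with x h1 h2
    rw [Prod.fst_add, h2, Pi.add_apply, h1, Pi.zero_apply, add_zero]
  · filter_upwards [ae_mono hle (ae_eq_zero_of_mem_W1pZero hyW).2,
      ae_mono hle' (Lp.coeFn_add (z i).2 y.2)] with x h1 h2
    rw [Prod.snd_add, h2, Pi.add_apply, h1, Pi.zero_apply, add_zero]

/-- Competitors for finitely many local Dirichlet problems on disjoint open sets can be glued. -/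
lemma exists_glue {α : ℝ} {F : Functional Ω m p} (hF : IsClassI α F) (hp : p ≠ ⊤)
    (hΩ : Bornology.IsBounded (Ω : Set (Euc d))) {O : Opens (Euc d)} (hO : O ≤ Ω) (u : W1p Ω m p)
    {ι : Type*} {s : Finset ι} {V : ι → Opens (Euc d)} (hVO : ∀ i ∈ s, V i ≤ O)
    (hdisj : (s : Set ι).PairwiseDisjoint fun i => (V i : Set (Euc d)))
    {c : ι → ℝ≥0∞} (hc : ∀ i ∈ s, dirichletInf F u.val (V i) < c i) :
    ∃ w : W1p Ω m p, ∃ z ∈ W1pZero Ω m p O, w.val = u.val + z.1 ∧ w.grad = u.grad + z.2 ∧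
      (∀ i ∈ s, F w (V i) < c i) ∧
      ∀ i ∈ s, ∀ (k : Fin d) (a ρ : ℝ), 0 ≤ ρ → (∀ y ∈ V i, |y k - a| < ρ / 2) →
        ∫⁻ x in (V i : Set (Euc d)), ‖z.1 x‖ₑ ^ p.toReal
          ≤ ENNReal.ofReal ρ ^ p.toReal *
            ∫⁻ x in (V i : Set (Euc d)), ‖z.2 x‖ₑ ^ p.toReal := by
  have hex : ∀ i ∈ s, ∃ v : W1p Ω m p, ∃ z ∈ W1pZero Ω m p (V i),
      ((v.val : Euc d → Euc m) =ᵐ[volume.restrict (Ω : Set (Euc d))] fun y => u.val y + z.1 y) ∧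
      F v (V i) < c i := by
    intro i hi
    have h := hc i hi
    simp only [dirichletInf, iInf_lt_iff] at h
    obtain ⟨v, ⟨z, hz, hv⟩, hlt⟩ := h
    exact ⟨v, z, hz, hv, hlt⟩
  choose! v z hz hv hlt using hex
  set y := ∑ i ∈ s, z i with hy
  have hyO : y ∈ W1pZero Ω m p O := sum_mem_W1pZero _ fun i hi => W1pZero_mono (hVO i hi) (hz i hi)
  have hVΩ : ∀ i ∈ s, V i ≤ Ω := fun i hi => (hVO i hi).trans hO
  refine ⟨u.addPair hΩ y (isWeakGradient_of_mem_W1pZero hΩ hO hyO), y, hyO, rfl, rfl, ?_, ?_⟩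
  · intro i hi
    -- The glued function agrees a.e. on `V i` with the local competitor, so locality transfers the
    -- energy bound.
    refine lt_of_eq_of_lt (hF.isLocal (V i) (hVΩ i hi) _ _ ?_) (hlt i hi)
    have hle : volume.restrict (V i : Set (Euc d)) ≤ volume.restrict (Ω : Set (Euc d)) :=
      Measure.restrict_mono_set _ (hVΩ i hi)
    filter_upwards [(ae_eq_sum_of_mem_W1pZero hVΩ hdisj hz hi).1, ae_mono hle (hv i hi),
      ae_mono hle (Lp.coeFn_add u.val y.1)] with x h1 h2 h3
    change (u.val + y.1 : LpFun Ω m p) x = _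
    rw [h3, h2, Pi.add_apply, h1]
  · intro i hi k a ρ hρ hslab
    have h := ae_eq_sum_of_mem_W1pZero hVΩ hdisj hz hi
    rw [lintegral_congr_ae (h.1.mono fun x hx =>
        (by simp only [hy, hx] : ‖y.1 x‖ₑ ^ p.toReal = ‖(z i).1 x‖ₑ ^ p.toReal)),
      lintegral_congr_ae (h.2.mono fun x hx =>
        (by simp only [hy, hx] : ‖y.2 x‖ₑ ^ p.toReal = ‖(z i).2 x‖ₑ ^ p.toReal))]
    exact lintegral_fst_le_of_slab hp (hVΩ i hi) k hρ hslab (hz i hi)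

end Glue

/-! ### Decomposing a set along finitely many cubes -/

section Cover

variable {d : ℕ}

/-- The open set left over by finitely many closed cubes. -/
def cubeRest (O : Opens (Euc d)) (T : Finset (ℝ × Euc d)) : Opens (Euc d) :=
  ⟨O \ ⋃ q ∈ T, closedCube q.1 q.2,
    O.isOpen.sdiff (T.finite_toSet.isClosed_biUnion fun q _ => isClosed_closedCube q.1 q.2)⟩

-- Only cubes meeting `A` are counted: this makes the energy estimate for the recovery functions
-- local. Cube boundaries are null.
open Classical in
lemma measure_le_cubeRest_add_sum {O : Opens (Euc d)} {T : Finset (ℝ × Euc d)}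
    (hT : ∀ q ∈ T, 0 < q.1) {ν : Measure (Euc d)} (hν : ν ≪ volume) {A : Set (Euc d)}
    (hA : A ⊆ O) :
    ν A ≤ ν (cubeRest O T) + ∑ q ∈ T with ((cube q.1 q.2 : Set (Euc d)) ∩ A).Nonempty,
      ν (cube q.1 q.2) := by
  have hsub : A ⊆ (cubeRest O T ∪ ⋃ q ∈ T.filter fun q =>
      ((cube q.1 q.2 : Set (Euc d)) ∩ A).Nonempty, (cube q.1 q.2 : Set (Euc d)))
      ∪ ⋃ q ∈ T, closedCube q.1 q.2 \ cube q.1 q.2 := by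
    intro x hx
    by_cases hxT : x ∈ ⋃ q ∈ T, closedCube q.1 q.2
    · obtain ⟨q, hq, hxq⟩ := mem_iUnion₂.1 hxT
      by_cases hxc : x ∈ cube q.1 q.2
      · exact Or.inl (Or.inr (mem_iUnion₂.2 ⟨q, Finset.mem_filter.2 ⟨hq, x, hxc, hx⟩, hxc⟩))
      · exact Or.inr (mem_iUnion₂.2 ⟨q, hq, hxq, hxc⟩)
    · exact Or.inl (Or.inl ⟨hA hx, hxT⟩)
  have hnull : ν (⋃ q ∈ T, closedCube q.1 q.2 \ cube q.1 q.2) = 0 := by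
    refine (measure_biUnion_null_iff T.countable_toSet).2 fun q hq => hν (volume_closedCube_diff_cube (hT q hq).le q.2)
  calc ν A ≤ _ := measure_mono hsub
    _ ≤ _ := measure_union_le _ _
    _ ≤ _ := by
      rw [hnull, add_zero]
      refine (measure_union_le _ _).trans ?_
      gcongr
      exact measure_biUnion_finset_le _ _

end Cover

/-! ### Recovery functions -/

section Recovery

variable {d m : ℕ} {Ω : Opens (Euc d)} {p : ℝ≥0∞} [Fact (1 ≤ p)]

/-- At a Lebesgue point of `G` where the lower density of `a` is controlled by `G`, the values of `a`
on small cubes are frequently controlled by the integral of `G`. -/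
lemma frequently_lt_lintegral_closedCube {a : ℝ → ℝ≥0∞} {G : Euc d → ℝ≥0∞} {x : Euc d}
    {β : ℝ} (hβ : 0 < β) (hGx : G x < ⊤)
    (hleb : Tendsto (fun ρ : ℝ => (∫⁻ y in closedCube ρ x, G y) / ENNReal.ofReal (ρ ^ d)) (𝓝[>] 0)
      (𝓝 (G x)))
    (ha : liminf (fun ρ : ℝ => a ρ / ENNReal.ofReal (ρ ^ d)) (𝓝[>] 0)
      ≤ G x + ENNReal.ofReal β) :
    ∃ᶠ ρ in 𝓝[>] (0 : ℝ),
      a ρ < (∫⁻ y in closedCube ρ x, G y) + ENNReal.ofReal (3 * β) * ENNReal.ofReal (ρ ^ d) := by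
  have hβ' : ENNReal.ofReal β ≠ 0 := by simpa using hβ
  have h1 : ∃ᶠ ρ in 𝓝[>] (0 : ℝ),
      a ρ / ENNReal.ofReal (ρ ^ d) < G x + ENNReal.ofReal β + ENNReal.ofReal β :=
    Filter.frequently_lt_of_liminf_lt (by isBoundedDefault)
      (ha.trans_lt (ENNReal.lt_add_right (by finiteness) hβ'))
  have h2 : ∀ᶠ ρ in 𝓝[>] (0 : ℝ),
      G x < (∫⁻ y in closedCube ρ x, G y) / ENNReal.ofReal (ρ ^ d) + ENNReal.ofReal β :=
    (hleb.add_const _).eventually (lt_mem_nhds (ENNReal.lt_add_right hGx.ne hβ'))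
  refine (h1.and_eventually (h2.and self_mem_nhdsWithin)).mono ?_
  rintro ρ ⟨h3, h4, hρ : 0 < ρ⟩
  have hρd : 0 < ρ ^ d := by positivity
  have h5 : a ρ / ENNReal.ofReal (ρ ^ d)
      < (∫⁻ y in closedCube ρ x, G y) / ENNReal.ofReal (ρ ^ d) + ENNReal.ofReal (3 * β) := by
    -- One `β` comes from the hypothesis on `a`, one makes the inequality strict, and one pays for
    -- replacing `G x` by its average.
    rw [show 3 * β = β + β + β by ring, ENNReal.ofReal_add (by positivity) hβ.le,
      ENNReal.ofReal_add hβ.le hβ.le, ← add_assoc, ← add_assoc]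
    exact h3.trans_le (by gcongr)
  rw [ENNReal.div_lt_iff (Or.inl (by simpa using hρd)) (Or.inl ENNReal.ofReal_ne_top), add_mul,
    ENNReal.div_mul_cancel (by simpa using hρd) ENNReal.ofReal_ne_top] at h5
  exact h5

lemma exists_slab_of_isBounded (hΩ : Bornology.IsBounded (Ω : Set (Euc d))) (k : Fin d) :
    ∃ D : ℝ, 0 ≤ D ∧ ∀ y ∈ Ω, |y k - 0| < D / 2 := by
  obtain ⟨M, hM⟩ := hΩ.subset_ball 0
  refine ⟨2 * |M|, by positivity, fun y hy => ?_⟩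
  have h1 := hM hy
  rw [mem_ball_zero_iff] at h1
  have h2 := PiLp.norm_apply_le y k
  rw [Real.norm_eq_abs] at h2
  rw [sub_zero]
  linarith [le_abs_self M]

omit [Fact (1 ≤ p)] in
lemma lintegral_grad_le {α : ℝ} (hα : 0 < α) {F : Functional Ω m p} (hF : IsClassI α F)
    (u : W1p Ω m p) {V : Opens (Euc d)} (hV : V ≤ Ω) :
    ∫⁻ x in (V : Set (Euc d)), ‖u.grad x‖ₑ ^ p.toReal ≤ (ENNReal.ofReal α)⁻¹ * F u V := by
  have h := hF.coercive V hV u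
  rw [mul_comm, ← div_eq_mul_inv]
  rw [ENNReal.le_div_iff_mul_le (Or.inl (by simpa using hα)) (Or.inl ENNReal.ofReal_ne_top),
    mul_comm]
  exact h

/-- The gradient of the correction is `∇w - ∇u`. Coercivity bounds the first term and convexity of
`t ↦ t^p` gives the factor `2^(p-1)`. -/
lemma lintegral_pair_snd_le {α : ℝ} (hα : 0 < α) {F : Functional Ω m p} (hF : IsClassI α F)
    (hp : p ≠ ⊤) {u w : W1p Ω m p} {z : LpFun Ω m p × LpGrad Ω m p} (hw : w.grad = u.grad + z.2)
    {V : Opens (Euc d)} (hV : V ≤ Ω) :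
    ∫⁻ x in (V : Set (Euc d)), ‖z.2 x‖ₑ ^ p.toReal
      ≤ 2 ^ (p.toReal - 1) * ((ENNReal.ofReal α)⁻¹ * F w V
        + ∫⁻ x in (V : Set (Euc d)), ‖u.grad x‖ₑ ^ p.toReal) := by
  have h1 := one_le_toReal_exponent hp
  have hle : volume.restrict (V : Set (Euc d)) ≤ volume.restrict (Ω : Set (Euc d)) :=
    Measure.restrict_mono_set _ hV
  have hm : ∀ v : LpGrad Ω m p, AEMeasurable (fun x => ‖v x‖ₑ ^ p.toReal)
      (volume.restrict (V : Set (Euc d))) := fun v =>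
    ((Lp.aestronglyMeasurable v).mono_measure hle).enorm.pow_const _
  calc _ ≤ ∫⁻ x in (V : Set (Euc d)), 2 ^ (p.toReal - 1) *
          (‖w.grad x‖ₑ ^ p.toReal + ‖u.grad x‖ₑ ^ p.toReal) := by
        refine lintegral_mono_ae ?_
        filter_upwards [ae_mono hle (Lp.coeFn_add u.grad z.2)] with x hx
        refine le_trans ?_ (ENNReal.rpow_add_le_mul_rpow_add_rpow _ _ h1)
        refine ENNReal.rpow_le_rpow ?_ (by linarith)
        have : z.2 x = w.grad x - u.grad x := by
          rw [hw, hx, Pi.add_apply, add_sub_cancel_left]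
        rw [this]
        exact enorm_sub_le
    _ = 2 ^ (p.toReal - 1) * ((∫⁻ x in (V : Set (Euc d)), ‖w.grad x‖ₑ ^ p.toReal)
        + ∫⁻ x in (V : Set (Euc d)), ‖u.grad x‖ₑ ^ p.toReal) := by
        rw [lintegral_const_mul' _ _ (ENNReal.rpow_ne_top_of_nonneg (by linarith) (by simp)),
          lintegral_add_left' (hm _)]
    _ ≤ _ := by
        gcongr
        exact lintegral_grad_le hα hF w hV

/-- Finite covering of `O`, up to small measure, by disjoint cubes on which the Dirichlet infimum is
controlled by the integral of `G`. -/
lemma exists_finset_cube_dirichletInf_lt (hd : 1 ≤ d) (F : Functional Ω m p) {O : Opens (Euc d)}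
    (u : W1p Ω m p) {G : Euc d → ℝ≥0∞} (hGm : Measurable G) (hG : ∫⁻ x, G x ≠ ⊤)
    {β : ℝ} (hβ : 0 < β)
    (hGS : ∀ A ⊆ (O : Set (Euc d)), MeasurableSet A →
      volume ({x ∈ (O : Set (Euc d)) | liminf (fun ρ : ℝ => dirichletInf F u.val (cube ρ x)
        / ENNReal.ofReal (ρ ^ d)) (𝓝[>] 0) ≤ G x + ENNReal.ofReal β} ∩ A) = 0 → volume A = 0)
    (ν : Measure (Euc d)) [IsFiniteMeasure ν] (hν : ν ≪ volume)
    {η : ℝ≥0∞} (hη : 0 < η) {δ : ℝ} (hδ : 0 < δ) :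
    ∃ T : Finset (ℝ × Euc d),
      (∀ q ∈ T, 0 < q.1 ∧ q.1 < δ ∧ dirichletInf F u.val (cube q.1 q.2)
          < (∫⁻ y in closedCube q.1 q.2, G y)
            + ENNReal.ofReal (3 * β) * ENNReal.ofReal (q.1 ^ d) ∧
        closedCube q.1 q.2 ⊆ O) ∧
      (T : Set (ℝ × Euc d)).PairwiseDisjoint (fun q => closedCube q.1 q.2) ∧
      ν (cubeRest O T) ≤ η := by
  set N : Set (Euc d) := {x | G x < ⊤ ∧ Tendsto
    (fun ρ : ℝ => (∫⁻ y in closedCube ρ x, G y) / ENNReal.ofReal (ρ ^ d)) (𝓝[>] 0) (𝓝 (G x))}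
  have hN : volume Nᶜ = 0 :=
    (ae_lt_top hGm hG).and (ae_tendsto_lintegral_closedCube hd hGm.aemeasurable hG)
  set S := {x ∈ (O : Set (Euc d)) | liminf (fun ρ : ℝ => dirichletInf F u.val (cube ρ x)
        / ENNReal.ofReal (ρ ^ d)) (𝓝[>] 0) ≤ G x + ENNReal.ofReal β}
  refine exists_finset_disjoint_closedCube hd O.isOpen (S := S ∩ N) (fun x hx => hx.1.1) ?_
    (P := fun ρ x => dirichletInf F u.val (cube ρ x) < (∫⁻ y in closedCube ρ x, G y)
            + ENNReal.ofReal (3 * β) * ENNReal.ofReal (ρ ^ d)) ?_ ν hν hη hδ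
  · intro A hAO hA h0
    refine hGS A hAO hA (measure_mono_null ?_ (measure_union_null h0 hN))
    rintro x ⟨hxS, hxA⟩
    by_cases hxN : x ∈ N
    · exact Or.inl ⟨⟨hxS, hxN⟩, hxA⟩
    · exact Or.inr hxN
  · intro x hx
    exact frequently_lt_lintegral_closedCube hβ hx.2.1 hx.2.2 hx.1.2

open Classical in
/-- Approximate recovery functions: competitors for the Dirichlet problem on `O`, close to `u` in
`L^p`, whose energy is controlled locally by the integral of `G`. -/
lemma exists_recovery (hd : 1 ≤ d) (hp : p ≠ ⊤) {α : ℝ} (hα : 0 < α)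
    (hΩ : Bornology.IsBounded (Ω : Set (Euc d))) {F : Functional Ω m p} (hF : IsClassI α F)
    {O : Opens (Euc d)} (hO : O ≤ Ω) (u : W1p Ω m p) {μ : Measure (Euc d)} [IsFiniteMeasure μ]
    (hμac : μ ≪ volume) (hμ : ∀ V ≤ O, dirichletInf F u.val V ≤ μ V)
    {G : Euc d → ℝ≥0∞} (hGm : Measurable G) (hG : ∫⁻ x, G x ≠ ⊤)
    (hGS : ∀ β : ℝ, 0 < β → ∀ A ⊆ (O : Set (Euc d)), MeasurableSet A →
      volume ({x ∈ (O : Set (Euc d)) | liminf (fun ρ : ℝ => dirichletInf F u.val (cube ρ x)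
        / ENNReal.ofReal (ρ ^ d)) (𝓝[>] 0) ≤ G x + ENNReal.ofReal β} ∩ A) = 0 → volume A = 0) :
    ∃ K : ℝ≥0∞, K ≠ ⊤ ∧ ∀ δ : ℝ, 0 < δ → δ ≤ 1 → ∃ w : W1p Ω m p,
      InDirichletClass O u.val w ∧ ‖w.val - u.val‖ₑ ^ p.toReal ≤ K * ENNReal.ofReal δ ∧
      ∀ V ≤ O, F w V
        ≤ (∫⁻ x in Metric.cthickening δ (V : Set (Euc d)), G x) + ENNReal.ofReal δ := by
  have h1 := one_le_toReal_exponent hp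
  obtain ⟨k⟩ : Nonempty (Fin d) := ⟨⟨0, hd⟩⟩
  obtain ⟨D, hD0, hD⟩ := exists_slab_of_isBounded hΩ k
  set U : ℝ≥0∞ := ∫⁻ x in (Ω : Set (Euc d)), ‖u.grad x‖ₑ ^ p.toReal with hU
  have hUtop : U ≠ ⊤ := by
    rw [hU, ← enorm_Lp_rpow hp]
    exact ENNReal.rpow_ne_top_of_nonneg (by linarith) (by simp)
  set C : ℝ≥0∞ := 2 ^ (p.toReal - 1)
  have hC : C ≠ ⊤ := ENNReal.rpow_ne_top_of_nonneg (by linarith) (by simp)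
  set a : ℝ≥0∞ := (ENNReal.ofReal α)⁻¹
  have ha : a ≠ ⊤ := by simp [a, hα]
  have hOtop : volume (O : Set (Euc d)) ≠ ⊤ := (hΩ.subset hO).measure_lt_top.ne
  have hDtop : ENNReal.ofReal D ^ p.toReal ≠ ⊤ :=
    ENNReal.rpow_ne_top_of_nonneg (by linarith) ENNReal.ofReal_ne_top
  -- The first term bounds the remainder set, where Poincaré only has the width `D` of `Ω` but the
  -- gradient energy is `O(δ)`. The second bounds the cubes, where the energy is only bounded but
  -- Poincaré gains a factor at most `δ`.
  refine ⟨ENNReal.ofReal D ^ p.toReal * (C * (a + 1)) + C * (a * ((∫⁻ x, G x) + 1) + U),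
    by finiteness, ?_⟩
  intro δ hδ hδ1
  set e : ℝ≥0∞ := ENNReal.ofReal δ with he
  have he0 : e ≠ 0 := by simpa [he] using hδ
  have hetop : e ≠ ⊤ := ENNReal.ofReal_ne_top
  have he1 : e ≤ 1 := by simpa [he] using hδ1
  have he4 : 0 < e / 4 := ENNReal.div_pos he0 (by simp)
  have he2 : e / 2 = ENNReal.ofReal (δ / 2) := by
    rw [ENNReal.ofReal_div_of_pos (by norm_num)]; simp [he]
  have he42 : e / 4 < e / 2 := by
    have h4 : e / 4 = ENNReal.ofReal (δ / 4) := by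
      rw [ENNReal.ofReal_div_of_pos (by norm_num)]; simp [he]
    rw [h4, he2, ENNReal.ofReal_lt_ofReal_iff (by positivity)]
    linarith
  have hd' : (1 : ℝ) ≤ d := by exact_mod_cast hd
  -- Chosen so that `3β|O| ≤ δ/2`; the `+ 1` covers `|O| = 0`.
  set β : ℝ := δ / 6 / ((volume (O : Set (Euc d))).toReal + 1) with hβdef
  have hv0 : 0 ≤ (volume (O : Set (Euc d))).toReal := ENNReal.toReal_nonneg
  have hβ : 0 < β := by positivity
  have hβO : ENNReal.ofReal (3 * β) * volume (O : Set (Euc d)) ≤ e / 2 := by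
    rw [he2, ← ENNReal.ofReal_toReal hOtop, ← ENNReal.ofReal_mul (by positivity)]
    refine ENNReal.ofReal_le_ofReal ?_
    have : β * ((volume (O : Set (Euc d))).toReal + 1) = δ / 6 := by
      rw [hβdef]; field_simp
    nlinarith
  -- The gradient energy of `u`, added to `μ` so that one covering makes the remainder small for
  -- both.
  set ν₀ : Measure (Euc d) := (volume.restrict (Ω : Set (Euc d))).withDensity
    fun x => ‖u.grad x‖ₑ ^ p.toReal
  have : IsFiniteMeasure ν₀ := isFiniteMeasure_withDensity hUtop
  have hν₀ : ν₀ ≪ volume :=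
    (withDensity_absolutelyContinuous _ _).trans Measure.restrict_le_self.absolutelyContinuous
  -- A cube of side below `δ/(2d)` has diameter below `δ`, so a cube meeting `V` lies in the
  -- `δ`-thickening of `V`.
  obtain ⟨T, hT, hTdisj, hTν⟩ := exists_finset_cube_dirichletInf_lt hd F u hGm hG hβ (hGS β hβ)
    (μ + ν₀) (hμac.add_left hν₀) he4 (δ := δ / (2 * d)) (by positivity)
  set R := cubeRest O T with hR
  have hRO : R ≤ O := fun x hx => hx.1
  have hμR : μ R ≤ e / 4 := (Measure.le_add_right le_rfl _).trans hTν
  have hUR : ∫⁻ x in (R : Set (Euc d)), ‖u.grad x‖ₑ ^ p.toReal ≤ e / 4 := by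
    have h := (Measure.le_add_left (le_refl ν₀) : ν₀ ≤ μ + ν₀) (R : Set (Euc d))
    rw [withDensity_apply _ R.isOpen.measurableSet, Measure.restrict_restrict R.isOpen.measurableSet,
      inter_eq_self_of_subset_left (hRO.trans hO)] at h
    exact h.trans hTν
  -- `none` indexes the remainder `R`, treated as one more Dirichlet problem. There `m(u; R) ≤ μ(R)
  -- ≤ e/4 < e/2` supplies the strict bound.
  let V : Option (ℝ × Euc d) → Opens (Euc d) := fun o => o.elim R fun q => cube q.1 q.2
  let c : Option (ℝ × Euc d) → ℝ≥0∞ := fun o => o.elim (e / 2) fun q =>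
    (∫⁻ y in closedCube q.1 q.2, G y) + ENNReal.ofReal (3 * β) * ENNReal.ofReal (q.1 ^ d)
  have hcO : ∀ q ∈ T, cube q.1 q.2 ≤ O := fun q hq =>
    (cube_subset_closedCube _ _).trans (hT q hq).2.2.2
  obtain ⟨w, z, hz, hwv, hwg, hFw, hpoin⟩ := exists_glue hF hp hΩ hO u
    (s := Finset.insertNone T) (V := V) (c := c) (by
      rintro (_ | q) hq
      · exact hRO
      · exact hcO q (Finset.some_mem_insertNone.1 hq)) (by
      rintro (_ | q) hq (_ | q') hq' hne
      · exact absurd rfl hne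
      · refine Set.disjoint_left.2 fun x hx hx' => hx.2 (mem_iUnion₂.2
          ⟨q', Finset.some_mem_insertNone.1 hq', cube_subset_closedCube _ _ hx'⟩)
      · refine Set.disjoint_left.2 fun x hx' hx => hx.2 (mem_iUnion₂.2
          ⟨q, Finset.some_mem_insertNone.1 hq, cube_subset_closedCube _ _ hx'⟩)
      · exact (hTdisj (Finset.some_mem_insertNone.1 hq) (Finset.some_mem_insertNone.1 hq')
          fun h => hne (congrArg some h)).mono (cube_subset_closedCube _ _)
            (cube_subset_closedCube _ _)) (by
      rintro (_ | q) hq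
      · exact (hμ R hRO).trans_lt (hμR.trans_lt he42)
      · exact (hT q (Finset.some_mem_insertNone.1 hq)).2.2.1)
  have hFR : F w R < e / 2 := hFw none Finset.none_mem_insertNone
  have hFq : ∀ q ∈ T, F w (cube q.1 q.2) < (∫⁻ y in closedCube q.1 q.2, G y)
      + ENNReal.ofReal (3 * β) * ENNReal.ofReal (q.1 ^ d) := fun q hq =>
    hFw (some q) (Finset.some_mem_insertNone.2 hq)
  have hFV : ∀ V ≤ O, F w V
      ≤ (∫⁻ x in Metric.cthickening δ (V : Set (Euc d)), G x) + ENNReal.ofReal δ := by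
    intro V hV
    obtain ⟨ν, hν, hνF⟩ := hF.measure w
    have hν' : ν ≪ volume := hν.trans Measure.restrict_le_self.absolutelyContinuous
    set T' := T.filter fun q => ((cube q.1 q.2 : Set (Euc d)) ∩ V).Nonempty with hT'
    have hT'T : ∀ q ∈ T', q ∈ T := fun q hq => (Finset.mem_filter.1 hq).1
    have hT'disj : (T' : Set (ℝ × Euc d)).PairwiseDisjoint fun q => closedCube q.1 q.2 :=
      hTdisj.subset hT'T
    have hcub : ∀ q ∈ T', MeasurableSet (closedCube q.1 q.2) := fun q _ =>
      (isClosed_closedCube _ _).measurableSet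
    calc F w V = ν V := hνF V (hV.trans hO)
      _ ≤ ν R + ∑ q ∈ T', ν (cube q.1 q.2) :=
        measure_le_cubeRest_add_sum (fun q hq => (hT q hq).1) hν' hV
      _ ≤ e / 2 + ∑ q ∈ T', ((∫⁻ y in closedCube q.1 q.2, G y)
          + ENNReal.ofReal (3 * β) * volume (closedCube q.1 q.2)) := by
        gcongr with q hq
        · rw [← hνF R (hRO.trans hO)]
          exact hFR.le
        · rw [← hνF _ ((hcO q (hT'T q hq)).trans hO), volume_closedCube (hT q (hT'T q hq)).1.le]
          exact (hFq q (hT'T q hq)).le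
      _ = e / 2 + ((∫⁻ y in ⋃ q ∈ T', closedCube q.1 q.2, G y)
          + ENNReal.ofReal (3 * β) * volume (⋃ q ∈ T', closedCube q.1 q.2)) := by
        rw [Finset.sum_add_distrib, ← Finset.mul_sum, measure_biUnion_finset hT'disj hcub,
          lintegral_biUnion_finset hT'disj hcub]
      _ ≤ e / 2 + ((∫⁻ x in Metric.cthickening δ (V : Set (Euc d)), G x) + e / 2) := by
        gcongr
        · refine iUnion₂_subset fun q hq x hx => ?_
          obtain ⟨hqT, y, hy, hyV⟩ := Finset.mem_filter.1 hq
          refine Metric.mem_cthickening_of_dist_le x y δ _ hyV ?_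
          have hx' := closedCube_subset_closedBall hd (hT q hqT).1.le q.2 hx
          have hy' := closedCube_subset_closedBall hd (hT q hqT).1.le q.2
            (cube_subset_closedCube _ _ hy)
          have hρ := (hT q hqT).2.1
          rw [lt_div_iff₀ (by positivity)] at hρ
          have := dist_triangle_right x y q.2
          rw [Metric.mem_closedBall] at hx' hy'
          nlinarith
        · refine le_trans ?_ hβO
          gcongr
          exact iUnion₂_subset fun q hq => (hT q (hT'T q hq)).2.2.2
      _ = _ := by
        rw [add_comm, add_assoc, ENNReal.add_halves]
  refine ⟨w, ⟨z, hz, ?_⟩, ?_, hFV⟩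
  · rw [hwv]
    exact Lp.coeFn_add _ _
  · rw [hwv, add_sub_cancel_left, enorm_Lp_rpow hp]
    have hq0 : 0 < p.toReal := by linarith
    rw [setLIntegral_enorm_rpow_eq_of_ae_eq_zero hq0 hO (ae_eq_zero_of_mem_W1pZero hz).1]
    -- The `L^p` mass of the correction is viewed as a measure so that it can be split along `R` and
    -- the cubes.
    set ν₁ : Measure (Euc d) := volume.withDensity fun x => ‖z.1 x‖ₑ ^ p.toReal
    have hν₁ : ∀ W : Opens (Euc d), ν₁ W = ∫⁻ x in (W : Set (Euc d)), ‖z.1 x‖ₑ ^ p.toReal :=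
      fun W => withDensity_apply _ W.isOpen.measurableSet
    have hFO : F w O ≤ (∫⁻ x, G x) + 1 :=
      (hFV O le_rfl).trans (add_le_add (setLIntegral_le_lintegral _ _) he1)
    have hcubes : ∑ q ∈ T, ∫⁻ x in (cube q.1 q.2 : Set (Euc d)), ‖z.2 x‖ₑ ^ p.toReal
        ≤ ∫⁻ x in (O : Set (Euc d)), ‖z.2 x‖ₑ ^ p.toReal := by
      rw [← lintegral_biUnion_finset (fun q hq q' hq' hne => (hTdisj hq hq' hne).mono
        (cube_subset_closedCube _ _) (cube_subset_closedCube _ _))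
        fun q _ => (cube q.1 q.2).isOpen.measurableSet]
      exact lintegral_mono_set (iUnion₂_subset hcO)
    have hρe : ∀ q ∈ T, ENNReal.ofReal q.1 ^ p.toReal ≤ e := by
      intro q hq
      have hqδ : q.1 ≤ δ := (hT q hq).2.1.le.trans (div_le_self hδ.le (by linarith))
      calc ENNReal.ofReal q.1 ^ p.toReal ≤ e ^ p.toReal :=
            ENNReal.rpow_le_rpow (ENNReal.ofReal_le_ofReal hqδ) hq0.le
        _ ≤ e ^ (1 : ℝ) := ENNReal.rpow_le_rpow_of_exponent_ge he1 h1
        _ = e := ENNReal.rpow_one e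
    calc ∫⁻ x in (O : Set (Euc d)), ‖z.1 x‖ₑ ^ p.toReal = ν₁ O := (hν₁ O).symm
      _ ≤ ν₁ R + ∑ q ∈ T, ν₁ (cube q.1 q.2) :=
        (measure_le_cubeRest_add_sum (fun q hq => (hT q hq).1)
          (withDensity_absolutelyContinuous _ _) le_rfl).trans (add_le_add le_rfl
            (Finset.sum_le_sum_of_subset (Finset.filter_subset _ _)))
      _ ≤ ENNReal.ofReal D ^ p.toReal * (∫⁻ x in (R : Set (Euc d)), ‖z.2 x‖ₑ ^ p.toReal)
          + ∑ q ∈ T, e * ∫⁻ x in (cube q.1 q.2 : Set (Euc d)), ‖z.2 x‖ₑ ^ p.toReal := by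
        gcongr with q hq
        · rw [hν₁]
          exact hpoin none Finset.none_mem_insertNone k 0 D hD0 fun y hy => hD y (hO (hRO hy))
        · rw [hν₁]
          exact (hpoin (some q) (Finset.some_mem_insertNone.2 hq) k (q.2 k) q.1 (hT q hq).1.le
            fun y hy => hy k).trans (mul_le_mul_left (hρe q hq) _)
      _ ≤ ENNReal.ofReal D ^ p.toReal * (C * (a * e + e))
          + e * (C * (a * ((∫⁻ x, G x) + 1) + U)) := by
        rw [← Finset.mul_sum]
        gcongr
        · refine (lintegral_pair_snd_le hα hF hp hwg (hRO.trans hO)).trans ?_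
          gcongr
          · exact hFR.le.trans ENNReal.half_le_self
          · exact hUR.trans (he42.le.trans ENNReal.half_le_self)
        · refine hcubes.trans ((lintegral_pair_snd_le hα hF hp hwg hO).trans ?_)
          gcongr
          exact lintegral_mono_set hO
      _ = _ := by ring

end Recovery

/-! ### Lower bound for energies and the measurable minorant -/

section Bounds

variable {d m : ℕ} {Ω : Opens (Euc d)} {p : ℝ≥0∞}

/-- The quantifier on `ε` stands inside the one on `ρ`: once finitely many cubes are selected, a
common range of `ε` works for all of them. -/
lemma eventually_lintegral_closedCube_lt {G : Euc d → ℝ≥0∞} {x : Euc d} {b : ℝ≥0∞} (hb : b ≠ 0)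
    (hGx : G x < ⊤)
    (hleb : Tendsto (fun ρ : ℝ => (∫⁻ y in closedCube ρ x, G y) / ENNReal.ofReal (ρ ^ d)) (𝓝[>] 0)
      (𝓝 (G x))) {a : ℝ → ℝ → ℝ≥0∞}
    (ha : G x ≤ limsup (fun ρ : ℝ =>
      liminf (fun ε : ℝ => a ε ρ / ENNReal.ofReal (ρ ^ d)) (𝓝[>] 0)) (𝓝[>] 0)) :
    ∃ᶠ ρ in 𝓝[>] (0 : ℝ), ∀ᶠ ε in 𝓝[>] (0 : ℝ),
      (∫⁻ y in closedCube ρ x, G y) < a ε ρ + 2 * b * ENNReal.ofReal (ρ ^ d) := by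
  have h2 : ∀ᶠ ρ in 𝓝[>] (0 : ℝ),
      (∫⁻ y in closedCube ρ x, G y) / ENNReal.ofReal (ρ ^ d) < G x + b :=
    hleb.eventually (gt_mem_nhds (ENNReal.lt_add_right hGx.ne hb))
  have h1 : ∃ᶠ ρ in 𝓝[>] (0 : ℝ), ∀ᶠ ε in 𝓝[>] (0 : ℝ),
      G x ≤ a ε ρ / ENNReal.ofReal (ρ ^ d) + b := by
    -- Going below the limsup needs `G x - b < G x`, which fails when `G x = 0`; for `G x ≤ b` the
    -- bound is trivial.
    rcases le_or_gt (G x) b with hle | hlt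
    · exact (Eventually.of_forall fun ρ => Eventually.of_forall fun ε =>
        hle.trans le_add_self).frequently
    · have hsub : G x - b < G x := ENNReal.sub_lt_self hGx.ne (zero_le.trans_lt hlt).ne' hb
      refine (frequently_lt_of_lt_limsup (by isBoundedDefault) (hsub.trans_le ha)).mono
        fun ρ hρ => ?_
      exact (eventually_lt_of_lt_liminf hρ).mono fun ε hε => tsub_le_iff_right.1 hε.le
  refine (h1.and_eventually (h2.and self_mem_nhdsWithin)).mono ?_
  rintro ρ ⟨h3, h4, hρ : 0 < ρ⟩
  have hρd : 0 < ρ ^ d := by positivity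
  filter_upwards [h3] with ε hε
  have h5 : (∫⁻ y in closedCube ρ x, G y) / ENNReal.ofReal (ρ ^ d)
      < a ε ρ / ENNReal.ofReal (ρ ^ d) + 2 * b := by
    rw [two_mul, ← add_assoc]
    exact h4.trans_le (by gcongr)
  rwa [ENNReal.div_lt_iff (Or.inl (by simpa using hρd)) (Or.inl ENNReal.ofReal_ne_top), add_mul,
    ENNReal.div_mul_cancel (by simpa using hρd) ENNReal.ofReal_ne_top] at h5

/-- Lower bound for the energies of a family from a lower bound for the densities. -/
lemma lintegral_le_liminf_of_le_density (hd : 1 ≤ d) {α : ℝ}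
    (hΩ : Bornology.IsBounded (Ω : Set (Euc d))) {F : Functional Ω m p} (hF : IsClassI α F)
    {O : Opens (Euc d)} (hO : O ≤ Ω) {G : Euc d → ℝ≥0∞} (hGm : Measurable G) (hG : ∫⁻ x, G x ≠ ⊤)
    (w : ℝ → W1p Ω m p)
    (hw : ∀ᵐ x ∂volume.restrict (O : Set (Euc d)), G x ≤ limsup (fun ρ : ℝ =>
      liminf (fun ε : ℝ => F (w ε) (cube ρ x) / ENNReal.ofReal (ρ ^ d)) (𝓝[>] 0)) (𝓝[>] 0)) :
    ∫⁻ x in (O : Set (Euc d)), G x ≤ liminf (fun ε => F (w ε) O) (𝓝[>] 0) := by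
  have hOtop : volume (O : Set (Euc d)) ≠ ⊤ := (hΩ.subset hO).measure_lt_top.ne
  refine ENNReal.le_of_forall_pos_le_add fun δ hδ _ => ?_
  set e : ℝ≥0∞ := (δ : ℝ≥0∞) with he
  have he2 : e / 2 ≠ 0 := by simp [he, hδ.ne']
  obtain ⟨b, hb, hbO⟩ := ENNReal.exists_nnreal_pos_mul_lt
    (ENNReal.mul_ne_top ENNReal.ofNat_ne_top hOtop : 2 * volume (O : Set (Euc d)) ≠ ⊤) he2
  set N : Set (Euc d) := {x | x ∈ O ∧ G x < ⊤ ∧ Tendsto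
    (fun ρ : ℝ => (∫⁻ y in closedCube ρ x, G y) / ENNReal.ofReal (ρ ^ d)) (𝓝[>] 0) (𝓝 (G x)) ∧
    G x ≤ limsup (fun ρ : ℝ =>
      liminf (fun ε : ℝ => F (w ε) (cube ρ x) / ENNReal.ofReal (ρ ^ d)) (𝓝[>] 0)) (𝓝[>] 0)}
  have hN : ∀ᵐ x, x ∈ (O : Set (Euc d)) → x ∈ N := by
    filter_upwards [ae_lt_top hGm hG, ae_tendsto_lintegral_closedCube hd hGm.aemeasurable hG,
      (ae_restrict_iff' O.isOpen.measurableSet).1 hw] with x h1 h2 h3 hx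
    exact ⟨hx, h1, h2, h3 hx⟩
  have : IsFiniteMeasure (volume.withDensity G) := isFiniteMeasure_withDensity hG
  obtain ⟨T, hT, hTdisj, hTν⟩ := exists_finset_disjoint_closedCube hd O.isOpen (S := N)
    (fun x hx => hx.1) (by
      intro A hAO _ h0
      refine measure_mono_null (t := (N ∩ A) ∪ {x | ¬(x ∈ (O : Set (Euc d)) → x ∈ N)}) ?_
        (measure_union_null h0 hN)
      intro x hx
      by_cases hxN : x ∈ N
      · exact Or.inl ⟨hxN, hx⟩
      · exact Or.inr fun h => hxN (h (hAO hx)))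
    (P := fun ρ x => ∀ᶠ ε in 𝓝[>] (0 : ℝ),
      (∫⁻ y in closedCube ρ x, G y) < F (w ε) (cube ρ x) + 2 * b * ENNReal.ofReal (ρ ^ d))
    (fun x hx => eventually_lintegral_closedCube_lt (by simpa using hb.ne')
      hx.2.1 hx.2.2.1 hx.2.2.2)
    (volume.withDensity G) (withDensity_absolutelyContinuous _ _) he2.bot_lt one_pos
  have hcub : ∀ q ∈ T, MeasurableSet (closedCube q.1 q.2) := fun q _ =>
    (isClosed_closedCube _ _).measurableSet
  have hcO : (⋃ q ∈ T, closedCube q.1 q.2) ⊆ O := iUnion₂_subset fun q hq => (hT q hq).2.2.2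
  have hcm : MeasurableSet (⋃ q ∈ T, closedCube q.1 q.2) := T.measurableSet_biUnion hcub
  rw [← tsub_le_iff_right]
  refine le_liminf_of_le (by isBoundedDefault) ?_
  have hev : ∀ᶠ ε in 𝓝[>] (0 : ℝ), ∀ q ∈ T, (∫⁻ y in closedCube q.1 q.2, G y)
      < F (w ε) (cube q.1 q.2) + 2 * b * ENNReal.ofReal (q.1 ^ d) :=
    (Filter.eventually_all_finset T).2 fun q hq => (hT q hq).2.2.1
  filter_upwards [hev] with ε hε
  rw [tsub_le_iff_right]
  obtain ⟨ν, -, hνF⟩ := hF.measure (w ε)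
  calc ∫⁻ x in (O : Set (Euc d)), G x
      = (∫⁻ x in (O \ ⋃ q ∈ T, closedCube q.1 q.2 : Set (Euc d)), G x)
        + ∫⁻ x in ⋃ q ∈ T, closedCube q.1 q.2, G x := by
        rw [← lintegral_inter_add_sdiff G (O : Set (Euc d)) hcm, inter_eq_self_of_subset_right hcO,
          add_comm]
    _ ≤ e / 2 + ∑ q ∈ T, (ν (cube q.1 q.2) + b * 2 * volume (closedCube q.1 q.2)) := by
        rw [← withDensity_apply _ (O.isOpen.measurableSet.diff hcm),
          lintegral_biUnion_finset hTdisj hcub]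
        gcongr with q hq
        rw [← hνF _ (((cube_subset_closedCube _ _).trans (hT q hq).2.2.2).trans hO),
          volume_closedCube (hT q hq).1.le, mul_comm (b : ℝ≥0∞)]
        exact (hε q hq).le
    _ = e / 2 + (ν (⋃ q ∈ T, (cube q.1 q.2 : Set (Euc d)))
        + b * (2 * volume (⋃ q ∈ T, closedCube q.1 q.2))) := by
        rw [Finset.sum_add_distrib, ← Finset.mul_sum, measure_biUnion_finset hTdisj hcub,
          measure_biUnion_finset (fun q hq q' hq' hne => (hTdisj hq hq' hne).mono
          (cube_subset_closedCube _ _) (cube_subset_closedCube _ _))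
          fun q _ => (cube q.1 q.2).isOpen.measurableSet, mul_assoc]
    _ ≤ e / 2 + (ν O + e / 2) := by
        gcongr
        · exact iUnion₂_subset fun q hq => (cube_subset_closedCube _ _).trans (hT q hq).2.2.2
        · exact (by gcongr : _ ≤ _).trans hbO.le
    _ = _ := by
        rw [hνF O hO, add_comm, add_assoc, ENNReal.add_halves]

/-- The largest measurable minorant of the lower density of the local Dirichlet infima. -/
lemma exists_measurable_minorant_density (hd : 1 ≤ d) {O : Opens (Euc d)}
    {a : Opens (Euc d) → ℝ≥0∞} {μ : Measure (Euc d)} [IsFiniteMeasure μ]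
    (hμ : ∀ V ≤ O, a V ≤ μ V) :
    ∃ G : Euc d → ℝ≥0∞, Measurable G ∧ ∫⁻ x, G x ≠ ⊤ ∧ (∀ x ∉ O, G x = 0) ∧
      (∀ x, G x ≤ liminf (fun ρ : ℝ => a (cube ρ x) / ENNReal.ofReal (ρ ^ d)) (𝓝[>] 0)) ∧
      ∀ β : ℝ, 0 < β → ∀ A ⊆ (O : Set (Euc d)), MeasurableSet A →
        volume ({x ∈ (O : Set (Euc d)) | liminf (fun ρ : ℝ => a (cube ρ x)
          / ENNReal.ofReal (ρ ^ d)) (𝓝[>] 0) ≤ G x + ENNReal.ofReal β} ∩ A) = 0 →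
        volume A = 0 := by
  have hOm := O.isOpen.measurableSet
  set g : Euc d → ℝ≥0∞ := fun x =>
    liminf (fun ρ : ℝ => a (cube ρ x) / ENNReal.ofReal (ρ ^ d)) (𝓝[>] 0) with hg
  -- For a function not known to be measurable, `∫⁻` is the lower integral, and it is attained by a
  -- measurable minorant.
  obtain ⟨G, hGm, hGg, hGint⟩ := exists_measurable_le_lintegral_eq
    (volume.restrict (O : Set (Euc d))) g
  have hgfin : ∫⁻ x in (O : Set (Euc d)), g x ≠ ⊤ := by
    -- The density of `μ` dominates `g` a.e. in `O`.
    refine ne_top_of_le_ne_top (measure_ne_top μ O) (le_trans ?_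
      (Measure.setLIntegral_rnDeriv_le (μ := μ) (ν := volume) (O : Set (Euc d))))
    refine lintegral_mono_ae ?_
    filter_upwards [ae_restrict_of_ae (ae_tendsto_measure_closedCube hd μ), ae_restrict_mem hOm]
      with x hx hxO
    rw [← hx.liminf_eq]
    refine liminf_le_liminf ?_
    filter_upwards [eventually_closedCube_subset hd O.isOpen hxO] with ρ hρ
    gcongr
    exact (hμ _ ((cube_subset_closedCube ρ x).trans hρ)).trans
      (measure_mono (cube_subset_closedCube ρ x))
  refine ⟨(O : Set (Euc d)).indicator G, hGm.indicator hOm, ?_, fun x hx => indicator_of_notMem hx _,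
    fun x => (indicator_le_self' (fun _ _ => zero_le) x).trans (hGg x), ?_⟩
  · rw [lintegral_indicator hOm, ← hGint]
    exact hgfin
  · intro β hβ A hAO hA h0
    -- If `{g ≤ G + β}` missed almost all of `A`, then `G + β 1_A` would be a measurable a.e.
    -- minorant of `g`. Its integral exceeds that of `G` unless `A` is null.
    have hle : ∫⁻ x in (O : Set (Euc d)), (G x + A.indicator (fun _ => ENNReal.ofReal β) x)
        ≤ ∫⁻ x in (O : Set (Euc d)), g x := by
      refine lintegral_mono_ae ?_
      filter_upwards [ae_restrict_of_ae (measure_eq_zero_iff_ae_notMem.1 h0), ae_restrict_mem hOm]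
        with x hx hxO
      by_cases hxA : x ∈ A
      · rw [indicator_of_mem hxA]
        by_contra hlt
        refine hx ⟨⟨hxO, ?_⟩, hxA⟩
        rw [indicator_of_mem hxO]
        exact (not_le.1 hlt).le
      · rw [indicator_of_notMem hxA, add_zero]
        exact hGg x
    rw [lintegral_add_left hGm, lintegral_indicator hA, setLIntegral_const,
      Measure.restrict_apply hA, inter_eq_self_of_subset_left hAO, hGint] at hle
    rw [hGint] at hgfin
    by_contra hA0
    exact (ENNReal.lt_add_right hgfin (mul_ne_zero (by simpa using hβ) hA0)).not_ge hle

end Bounds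

/-! ### Energy densities, bounded families and conclusion -/

section Main

variable {d m : ℕ} {Ω : Opens (Euc d)} {p : ℝ≥0∞}

/-- Densities of energies that are controlled by the integral of `G` up to vanishing errors. -/
lemma ae_limsup_density_le (hd : 1 ≤ d) {O : Opens (Euc d)} {G : Euc d → ℝ≥0∞}
    (hGm : Measurable G) (hG : ∫⁻ x, G x ≠ ⊤) {a : ℝ → Opens (Euc d) → ℝ≥0∞}
    (ha : ∀ᶠ ε in 𝓝[>] (0 : ℝ), ∀ V ≤ O,
      a ε V ≤ (∫⁻ x in Metric.cthickening ε (V : Set (Euc d)), G x) + ENNReal.ofReal ε) :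
    ∀ᵐ x ∂volume.restrict (O : Set (Euc d)), limsup (fun ρ : ℝ =>
      liminf (fun ε : ℝ => a ε (cube ρ x) / ENNReal.ofReal (ρ ^ d)) (𝓝[>] 0)) (𝓝[>] 0) ≤ G x := by
  have : IsFiniteMeasure (volume.withDensity G) := isFiniteMeasure_withDensity hG
  filter_upwards [ae_restrict_of_ae (ae_tendsto_lintegral_closedCube hd hGm.aemeasurable hG),
    ae_restrict_mem O.isOpen.measurableSet] with x hx hxO
  rw [← hx.limsup_eq]
  refine limsup_le_limsup ?_
  filter_upwards [eventually_closedCube_subset hd O.isOpen hxO, self_mem_nhdsWithin]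
    with ρ hρ (hρ0 : 0 < ρ)
  have hVO : cube ρ x ≤ O := (cube_subset_closedCube ρ x).trans hρ
  -- As `ε → 0` the thickenings shrink to the closure of the cube, which lies in the closed cube.
  have ht : Tendsto (fun ε : ℝ => ((∫⁻ y in Metric.cthickening ε (cube ρ x : Set (Euc d)), G y)
      + ENNReal.ofReal ε) / ENNReal.ofReal (ρ ^ d)) (𝓝[>] 0)
      (𝓝 ((∫⁻ y in closure (cube ρ x : Set (Euc d)), G y) / ENNReal.ofReal (ρ ^ d))) := by
    refine ENNReal.Tendsto.div_const ?_ (Or.inr (by simpa using pow_pos hρ0 d))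
    have h1 := tendsto_measure_cthickening (μ := volume.withDensity G)
      (s := (cube ρ x : Set (Euc d))) ⟨1, one_pos, measure_ne_top _ _⟩
    simp only [withDensity_apply _ Metric.isClosed_cthickening.measurableSet,
      withDensity_apply _ isClosed_closure.measurableSet] at h1
    have h2 : Tendsto (fun ε : ℝ => ENNReal.ofReal ε) (𝓝 0) (𝓝 0) := by
      simpa using (ENNReal.continuous_ofReal.tendsto 0)
    simpa using (h1.add h2).mono_left nhdsWithin_le_nhds
  calc _ ≤ _ := liminf_le_liminf (ha.mono fun ε hε => by
        gcongr
        exact hε _ hVO)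
    _ = _ := ht.liminf_eq
    _ ≤ _ := by
      gcongr
      exact closure_minimal (cube_subset_closedCube ρ x) (isClosed_closedCube ρ x)

variable [Fact (1 ≤ p)]

lemma mPlus_const (F : Functional Ω m p) : mPlus (fun _ : ℝ => F) = dirichletInf F := by
  funext g V
  simp [mPlus]

lemma mMinus_const (F : Functional Ω m p) : mMinus (fun _ : ℝ => F) = dirichletInf F := by
  funext g V
  simp [mMinus]

lemma inDirichletClass_self (V : Opens (Euc d)) (u : W1p Ω m p) : InDirichletClass V u.val u := by
  refine ⟨0, zero_mem_W1pZero V, ?_⟩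
  filter_upwards [Lp.coeFn_zero (Euc m) p (volume.restrict (Ω : Set (Euc d)))] with x hx
  rw [Prod.fst_zero, hx, Pi.zero_apply, add_zero]

/-- Reduction to families with uniformly bounded energy in the lower bound for the relaxation. -/
lemma le_relaxation {F : Functional Ω m p} {O : Opens (Euc d)} {u : W1p Ω m p} {c : ℝ≥0∞}
    (h : ∀ w : ℝ → W1p Ω m p, Tendsto (fun ε => (w ε).val) (𝓝[>] 0) (𝓝 u.val) →
      (⨆ ε ∈ Ioc (0 : ℝ) 1, F (w ε) O) < ⊤ → c ≤ liminf (fun ε => F (w ε) O) (𝓝[>] 0)) :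
    c ≤ relaxation F u O := by
  refine le_iInf₂ fun v hv => ?_
  by_contra! hlt
  obtain ⟨t, ht1, ht2⟩ := exists_between hlt
  have hfr : ∃ᶠ ε in 𝓝[>] (0 : ℝ), F (v ε) O < t :=
    frequently_lt_of_liminf_lt (by isBoundedDefault) ht1
  -- Reparametrise: each `ε` is sent to some smaller parameter with energy below `t`. This bounds
  -- the energy for all `ε` in `]0,1]` and keeps convergence to `u`.
  have hex : ∀ ε : ℝ, 0 < ε → ∃ ε', ε' ∈ Ioc 0 ε ∧ F (v ε') O < t := fun ε hε =>
    ((hfr.and_eventually (Ioc_mem_nhdsGT hε)).exists).imp fun _ h => ⟨h.2, h.1⟩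
  choose! s hs hst using hex
  have hs0 : Tendsto s (𝓝[>] 0) (𝓝[>] 0) := by
    refine tendsto_nhdsWithin_iff.2 ⟨?_, ?_⟩
    · refine tendsto_of_tendsto_of_tendsto_of_le_of_le' tendsto_const_nhds
        (tendsto_nhdsWithin_of_tendsto_nhds tendsto_id) ?_ ?_
      · filter_upwards [self_mem_nhdsWithin] with ε hε using (hs ε hε).1.le
      · filter_upwards [self_mem_nhdsWithin] with ε hε using (hs ε hε).2
    · filter_upwards [self_mem_nhdsWithin] with ε hε using (hs ε hε).1
  have hc := h (fun ε => v (s ε)) (hv.comp hs0)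
    ((iSup₂_le fun ε hε => (hst ε hε.1).le).trans_lt (ht2.trans_le le_top))
  refine (hc.trans ?_).not_gt ht2
  refine liminf_le_of_le (by isBoundedDefault) fun b hb => ?_
  obtain ⟨ε, h1, h2⟩ := (hb.and self_mem_nhdsWithin).exists
  exact h1.trans (hst ε h2).le

end Main

end Relaxation

end

open Relaxation in
theorem mainTheorem8 {d m : ℕ} (hd : 1 ≤ d) (hm : 1 ≤ m)
    (p : ℝ≥0∞) [Fact (1 ≤ p)] (hp1 : 1 < p) (hp : p ≠ ⊤) (α : ℝ) (hα : 0 < α)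
    (Ω : Opens (Relaxation.Euc d)) (hΩ : Bornology.IsBounded (Ω : Set (Relaxation.Euc d)))
    (F : Relaxation.Functional Ω m p) (hF : Relaxation.IsClassI α F)
    (O : Opens (Relaxation.Euc d)) (hO : O ≤ Ω)
    (u : Relaxation.W1p Ω m p) (hu : u ∈ Relaxation.MSet (fun _ : ℝ => F) O)
    (h0 : Relaxation.CondH0 (fun _ : ℝ => F) O u)
    (h1 : Relaxation.CondH1 (fun _ : ℝ => F) O u)
    (h2 : Relaxation.CondH2 (fun _ : ℝ => F) O u) :
    ∃ L : Relaxation.Euc d → ℝ≥0∞,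
      AEMeasurable L (volume.restrict (O : Set (Relaxation.Euc d))) ∧
      (∀ᵐ x ∂volume.restrict (O : Set (Relaxation.Euc d)),
        Tendsto (fun ρ : ℝ =>
            Relaxation.dirichletInf F (Relaxation.tangentMap u x) (Relaxation.cube ρ x)
              / ENNReal.ofReal (ρ ^ d))
          (𝓝[>] 0) (𝓝 (L x))) ∧
      Relaxation.relaxation F u O = Relaxation.dirichletRelaxation F u O ∧
      Relaxation.dirichletRelaxation F u O
        = ∫⁻ x in (O : Set (Relaxation.Euc d)), L x := by
  unfold CondH0 at h0
  unfold CondH1 at h1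
  unfold CondH2 at h2
  simp only [mPlus_const, mMinus_const] at h0 h1 h2
  obtain ⟨μ, hμfin, hμac, hμ⟩ := hu
  have hμ' : ∀ V ≤ O, dirichletInf F u.val V ≤ μ V := fun V hV =>
    (le_iSup₂_of_le (f := fun (ε : ℝ) (_ : ε ∈ Ioc (0 : ℝ) 1) => dirichletInf F u.val V) 1
      (right_mem_Ioc.2 one_pos) le_rfl).trans (hμ V hV)
  obtain ⟨G, hGm, hG, hGO, hGle, hGS⟩ := exists_measurable_minorant_density hd hμ'
  obtain ⟨K, hK, hrec⟩ := exists_recovery hd hp hα hΩ hF hO u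
    (hμac.trans Measure.restrict_le_self.absolutelyContinuous) hμ' hGm hG hGS
  have hintG : ∫⁻ x in (O : Set (Euc d)), G x = ∫⁻ x, G x :=
    setLIntegral_eq_of_support_subset fun x hx => by_contra fun hxO => hx (hGO x hxO)
  -- Membership in the Dirichlet class is required for every real `ε`; outside `]0,1]` the default
  -- is `u` itself.
  have hfam : ∀ ε : ℝ, ∃ w : W1p Ω m p, InDirichletClass O u.val w ∧ (ε ∈ Ioc (0 : ℝ) 1 →
      ‖w.val - u.val‖ₑ ^ p.toReal ≤ K * ENNReal.ofReal ε ∧ ∀ V ≤ O, F w V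
        ≤ (∫⁻ x in Metric.cthickening ε (V : Set (Euc d)), G x) + ENNReal.ofReal ε) := by
    intro ε
    by_cases hε : ε ∈ Ioc (0 : ℝ) 1
    · obtain ⟨w, h1, h2⟩ := hrec ε hε.1 hε.2
      exact ⟨w, h1, fun _ => h2⟩
    · exact ⟨u, inDirichletClass_self O u, fun h => absurd h hε⟩
  choose w hwO hw using hfam
  have hev : ∀ᶠ ε in 𝓝[>] (0 : ℝ), ε ∈ Ioc (0 : ℝ) 1 := Ioc_mem_nhdsGT one_pos
  have hofReal : Tendsto ENNReal.ofReal (𝓝[>] 0) (𝓝 0) := by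
    simpa using (ENNReal.continuous_ofReal.tendsto 0).mono_left nhdsWithin_le_nhds
  have hwu : Tendsto (fun ε => (w ε).val) (𝓝[>] 0) (𝓝 u.val) := by
    have hpos : 0 < p.toReal := zero_lt_one.trans_le (one_le_toReal_exponent hp)
    rw [tendsto_iff_edist_tendsto_0]
    have hlim : Tendsto (fun ε : ℝ => (K * ENNReal.ofReal ε) ^ (1 / p.toReal)) (𝓝[>] 0) (𝓝 0) := by
      have := (ENNReal.Tendsto.const_mul hofReal (Or.inr hK)).ennrpow_const (1 / p.toReal)
      rwa [mul_zero, ENNReal.zero_rpow_of_pos (by positivity)] at this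
    refine tendsto_of_tendsto_of_tendsto_of_le_of_le' tendsto_const_nhds hlim
      (Eventually.of_forall fun _ => zero_le) ?_
    filter_upwards [hev] with ε hε
    rw [edist_eq_enorm_sub, one_div, ENNReal.le_rpow_inv_iff hpos]
    exact (hw ε hε).1
  have hwF : ∀ ε ∈ Ioc (0 : ℝ) 1, F (w ε) O ≤ (∫⁻ x, G x) + ENNReal.ofReal ε := fun ε hε =>
    ((hw ε hε).2 O le_rfl).trans (add_le_add (setLIntegral_le_lintegral _ _) le_rfl)
  have hwsup : (⨆ ε ∈ Ioc (0 : ℝ) 1, F (w ε) O) < ⊤ := by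
    refine (iSup₂_le fun ε hε => (hwF ε hε).trans ?_ :
      _ ≤ (∫⁻ x, G x) + 1).trans_lt (by finiteness)
    gcongr
    simpa using hε.2
  -- (H1) for the recovery family bounds the lower density of `m(u_x; ·)` by `G`. With (H0), (H2)
  -- and `G ≤ g` the chain of inequalities collapses.
  have hkey : ∀ᵐ x ∂volume.restrict (O : Set (Euc d)),
      Tendsto (fun ρ : ℝ => dirichletInf F (tangentMap u x) (cube ρ x) / ENNReal.ofReal (ρ ^ d))
        (𝓝[>] 0) (𝓝 (G x)) := by
    filter_upwards [h0, h1 w hwu hwsup, h2,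
      ae_limsup_density_le hd hGm hG (a := fun ε V => F (w ε) V)
        (hev.mono fun ε hε => (hw ε hε).2)] with x hx0 hx1 hx2 hx3
    have hle := hx1.trans hx3
    exact tendsto_of_le_liminf_of_limsup_le ((hGle x).trans (hx2.trans hx0)) (hx0.trans hle)
  have hle1 : relaxation F u O ≤ dirichletRelaxation F u O :=
    le_iInf₂ fun v hv => iInf₂_le_of_le v hv.2 le_rfl
  have hle2 : dirichletRelaxation F u O ≤ ∫⁻ x in (O : Set (Euc d)), G x := by
    refine iInf₂_le_of_le w ⟨hwO, hwu⟩ ?_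
    rw [hintG]
    have hlim : Tendsto (fun ε : ℝ => (∫⁻ x, G x) + ENNReal.ofReal ε) (𝓝[>] 0)
        (𝓝 (∫⁻ x, G x)) := by simpa using hofReal.const_add (∫⁻ x, G x)
    exact (liminf_le_liminf (hev.mono hwF)).trans hlim.liminf_eq.le
  have hle3 : ∫⁻ x in (O : Set (Euc d)), G x ≤ relaxation F u O := by
    refine le_relaxation fun v hv hvsup =>
      lintegral_le_liminf_of_le_density hd hΩ hF hO hGm hG v ?_
    filter_upwards [hkey, h1 v hv hvsup] with x hx hx1
    exact hx.liminf_eq.symm.le.trans hx1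
  exact ⟨G, hGm.aemeasurable, hkey, le_antisymm hle1 (hle2.trans hle3),
    le_antisymm hle2 (hle3.trans hle1)⟩
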